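/- Let $\mathbb{U}$ be a compact Lie group, $X$ a paracompact Hausdorff space with a continuous $\mathbb{U}$-action, and $\Bbbk\in\{\mathbb{R},\mathbb{C}\}$. Let $\mathcal{E}\to X$ be a continuous $\mathbb{U}$-equivariant bundle of one of the following types: (1) a Banach bundle over $\Bbbk$; (2) a Hilbert bundle over $\Bbbk$; (3) a Banach-algebra bundle over $\Bbbk$ all of whose fibers are semisimple; (4) a (complex) $C^*$ bundle. Assume that $\mathcal{E}$ is subhomogeneous, i.e. its fibers are finite-dimensional, of dimension bounded by a global constant. Then the following are equivalent: (a) $\mathcal{E}$ is locally homogeneous: every $x\in X$ has an open neighborhood over which the fibers are mutually isomorphic; (b) $\mathcal{E}$ is locally trivial: $X$ is covered by open sets $V$ for which there is an isomorphism $\mathcal{E}|_V\cong V\times F$ over $V$, for some object $F$ of the respective type (depending on $V$); (c) $\mathcal{E}$ is equivariantly locally trivial: every $x\in X$, with isotropy group $\mathbb{U}_x=\{g\in\mathbb{U} : gx=x\}$, has a $\mathbb{U}_x$-invariant open neighborhood $V$ for which there is a $\mathbb{U}_x$-equivariant isomorphism $\mathcal{E}|_V\cong V\times F$ over $V$, where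 $F$ is an object of the respective type carrying a continuous $\mathbb{U}_x$-action by automorphisms and $\mathbb{U}_x$ acts diagonally on $V\times F$. Conventions. A continuous Banach bundle is a continuous open surjection $\pi:\mathcal{E}\to X$ whose fibers $\mathcal{E}_x=\pi^{-1}(x)$ are Banach spaces, such that addition $\mathcal{E}\times_X\mathcal{E}\to\mathcal{E}$, scaling $\Bbbk\times\mathcal{E}\to\mathcal{E}$ and the norm $\mathcal{E}\to\mathbb{R}$ are continuous, and such that for every $x\in X$ the sets $\{v\in\pi^{-1}(V) : \|v\|<\varepsilon\}$, for $V\ni x$ open and $\varepsilon>0$, form a neighborhood base at $0_x$. In a Hilbert, Banach-algebra or $C^*$ bundle the fibers are Hilbert spaces, (not necessarily unital) Banach algebras or $C^*$-algebras, with continuous multiplication in the last two cases and continuous involution in the last. The bundle is $\mathbb{U}$-equivariant if it carries a continuous action of $\mathbb{U}$ on $\mathcal{E}$ for which $\pi$ is equivariant and the maps $\mathcal{E}_x\to\mathcal{E}_{gx}$ are linear, multiplicative in the Banach-algebra and $C^*$ cases, and $*$-preserving in the $C^*$ case (they are not required to be isometric). Isomorphisms of objects are linear homeomorphisms, multiplicative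 in the Banach-algebra and $C^*$ cases and $*$-preserving in the $C^*$ case; they need not be isometric. Isomorphisms of bundles over $V$ are homeomorphisms over $V$ that restrict to such isomorphisms on every fiber. -/

import Mathlib

open Bundle Topology Set
open scoped Manifold ContDiff

namespace BanachBundles

universe u v w

/-- The total space of a family `E` of fibers over `X`. The model-fiber argument of Mathlib's
`TotalSpace` is a phantom and plays no role: fibers over different points may be different. -/
abbrev Tot {X : Type u} (E : X → Type v) : Type (max u v) := TotalSpace Unit E

section Banach

variable (𝕜 : Type w) [RCLike 𝕜] {X : Type u} [TopologicalSpace X] (E : X → Type v)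
  [∀ x, NormedAddCommGroup (E x)] [∀ x, NormedSpace 𝕜 (E x)] [TopologicalSpace (Tot E)]

/-- A topology on the total space of a family of normed spaces makes it a *continuous* (F) Banach
bundle (completeness of the fibers is a separate type-class assumption). Surjectivity of the
projection is automatic, because every fiber contains `0`. The fiberwise product `E ×ᵇ E` carries
the topology induced from the square of the total space. -/
structure IsBanachBundle : Prop where
  continuous_proj : Continuous (TotalSpace.proj : Tot E → X)
  isOpenMap_proj : IsOpenMap (TotalSpace.proj : Tot E → X)
  continuous_add : Continuous fun p : TotalSpace (Unit × Unit) (E ×ᵇ E) =>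
    (⟨p.proj, p.snd.1 + p.snd.2⟩ : Tot E)
  continuous_smul : Continuous fun p : 𝕜 × Tot E => (⟨p.2.proj, p.1 • p.2.snd⟩ : Tot E)
  continuous_norm : Continuous fun p : Tot E => ‖p.snd‖
  nhds_zero_hasBasis : ∀ x : X, (𝓝 (⟨x, 0⟩ : Tot E)).HasBasis
    (fun q : Set X × ℝ => IsOpen q.1 ∧ x ∈ q.1 ∧ 0 < q.2)
    (fun q => {p : Tot E | p.proj ∈ q.1 ∧ ‖p.snd‖ < q.2})

/-- The fibers are finite-dimensional, with a global finite bound on the dimensions. -/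
def Subhomogeneous : Prop :=
  ∃ n : ℕ, ∀ x, FiniteDimensional 𝕜 (E x) ∧ Module.finrank 𝕜 (E x) ≤ n

/-- An identification of the bundle over the open set `toTriv.baseSet` with the product
`toTriv.baseSet × F`: a homeomorphism over the base which restricts to a linear homeomorphism (not
necessarily an isometry) on every fiber. -/
structure LocalTriv (F : Type v) [NormedAddCommGroup F] [NormedSpace 𝕜 F] where
  toTriv : Trivialization F (TotalSpace.proj : Tot E → X)
  fiberEquiv : ∀ x ∈ toTriv.baseSet, E x ≃L[𝕜] F
  toTriv_apply : ∀ (x : X) (hx : x ∈ toTriv.baseSet) (a : E x),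
    toTriv (⟨x, a⟩ : Tot E) = (x, fiberEquiv x hx a)

/-- Every point has an open neighborhood over which the fibers are finite-dimensional and mutually
isomorphic as topological vector spaces. This is also the notion used for Hilbert bundles. -/
def LocallyHomogeneous : Prop :=
  ∀ x : X, ∃ U : Set X, IsOpen U ∧ x ∈ U ∧ (∀ y ∈ U, FiniteDimensional 𝕜 (E y)) ∧
    ∀ y ∈ U, ∀ z ∈ U, Nonempty (E y ≃L[𝕜] E z)

/-- Local triviality of a Banach bundle: the model fibers are Banach spaces. -/
def LocallyTrivial : Prop :=
  ∀ x : X, ∃ (F : Type v) (_ : NormedAddCommGroup F) (_ : NormedSpace 𝕜 F) (_ : CompleteSpace F)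
    (t : LocalTriv 𝕜 E F), x ∈ t.toTriv.baseSet

/-- A continuous action of `G` on the total space, covering the action on the base and linear on
fibers. -/
structure BundleAction (G : Type*) [Group G] [TopologicalSpace G] [MulAction G X] where
  map : ∀ (g : G) (x : X), E x →ₗ[𝕜] E (g • x)
  map_one : ∀ (x : X) (a : E x), (⟨(1 : G) • x, map 1 x a⟩ : Tot E) = ⟨x, a⟩
  map_mul : ∀ (g h : G) (x : X) (a : E x),
    (⟨(g * h) • x, map (g * h) x a⟩ : Tot E) = ⟨g • h • x, map g (h • x) (map h x a)⟩
  continuous_map : Continuous fun p : G × Tot E =>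
    (⟨p.1 • p.2.proj, map p.1 p.2.proj p.2.snd⟩ : Tot E)

variable {𝕜 E}

/-- The local trivialization `t` is defined over a neighborhood of `x` that is invariant under the
isotropy group `Gₓ` of `x`, and it is `Gₓ`-equivariant when `Gₓ` acts on the model fiber through the
continuous linear representation `ρ` and on the product diagonally. -/
structure LocalTriv.IsEquivariantAt {F : Type v} [NormedAddCommGroup F] [NormedSpace 𝕜 F]
    (t : LocalTriv 𝕜 E F) {G : Type*} [Group G] [TopologicalSpace G] [MulAction G X]
    (α : BundleAction 𝕜 E G) (x : X) (ρ : MulAction.stabilizer G x →* (F ≃L[𝕜] F)) : Prop where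
  mem_baseSet : x ∈ t.toTriv.baseSet
  smul_mem : ∀ (k : MulAction.stabilizer G x), ∀ y ∈ t.toTriv.baseSet,
    (k : G) • y ∈ t.toTriv.baseSet
  continuous_rep : Continuous fun p : MulAction.stabilizer G x × F => ρ p.1 p.2
  equivariant : ∀ (k : MulAction.stabilizer G x) (y : X) (hy : y ∈ t.toTriv.baseSet) (a : E y),
    t.fiberEquiv ((k : G) • y) (smul_mem k y hy) (α.map k y a) = ρ k (t.fiberEquiv y hy a)

/-- Equivariant local triviality of a Banach bundle with `G`-action: around every point `x` the
bundle is equivariantly isomorphic, over an open set invariant under the isotropy group `Gₓ`, to a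
product with a Banach space on which `Gₓ` acts. -/
def EquivariantlyLocallyTrivial {G : Type*} [Group G] [TopologicalSpace G] [MulAction G X]
    (α : BundleAction 𝕜 E G) : Prop :=
  ∀ x : X, ∃ (F : Type v) (_ : NormedAddCommGroup F) (_ : NormedSpace 𝕜 F) (_ : CompleteSpace F)
    (t : LocalTriv 𝕜 E F) (ρ : MulAction.stabilizer G x →* (F ≃L[𝕜] F)), t.IsEquivariantAt α x ρ

end Banach

section Hilbert

variable (𝕜 : Type w) [RCLike 𝕜] {X : Type u} [TopologicalSpace X] (E : X → Type v)
  [∀ x, NormedAddCommGroup (E x)] [∀ x, InnerProductSpace 𝕜 (E x)] [TopologicalSpace (Tot E)]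

/-- Local triviality of a Hilbert bundle: the model fibers are Hilbert spaces. -/
def HilbertLocallyTrivial : Prop :=
  ∀ x : X, ∃ (F : Type v) (_ : NormedAddCommGroup F) (_ : InnerProductSpace 𝕜 F)
    (_ : CompleteSpace F) (t : LocalTriv 𝕜 E F), x ∈ t.toTriv.baseSet

variable {𝕜 E}

/-- Equivariant local triviality of a Hilbert bundle: the model fibers are Hilbert spaces. -/
def HilbertEquivariantlyLocallyTrivial {G : Type*} [Group G] [TopologicalSpace G] [MulAction G X]
    (α : BundleAction 𝕜 E G) : Prop :=
  ∀ x : X, ∃ (F : Type v) (_ : NormedAddCommGroup F) (_ : InnerProductSpace 𝕜 F)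
    (_ : CompleteSpace F) (t : LocalTriv 𝕜 E F)
    (ρ : MulAction.stabilizer G x →* (F ≃L[𝕜] F)), t.IsEquivariantAt α x ρ

end Hilbert

section Algebra

/-- The map `f` is multiplicative. -/
def PreservesMul {A B : Type*} [Mul A] [Mul B] (f : A → B) : Prop :=
  ∀ a b, f (a * b) = f a * f b

/-- The map `f` intertwines the involutions. -/
def PreservesStar {A B : Type*} [Star A] [Star B] (f : A → B) : Prop :=
  ∀ a, f (star a) = star (f a)

/-- A possibly non-unital ring is (Jacobson) semisimple if its Jacobson radical
`{a | every element of A a is quasi-regular}` vanishes. -/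
def IsJacobsonSemisimple (A : Type*) [NonUnitalRing A] : Prop :=
  ∀ a : A, (∀ b : A, IsQuasiregular (b * a)) → a = 0

variable (𝕜 : Type w) [RCLike 𝕜] {X : Type u} [TopologicalSpace X] (E : X → Type v)
  [∀ x, NonUnitalNormedRing (E x)] [∀ x, NormedSpace 𝕜 (E x)] [TopologicalSpace (Tot E)]

/-- A continuous Banach bundle with normed-algebra fibers and continuous multiplication. -/
structure IsBanachAlgebraBundle : Prop extends IsBanachBundle 𝕜 E where
  continuous_mul : Continuous fun p : TotalSpace (Unit × Unit) (E ×ᵇ E) =>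
    (⟨p.proj, p.snd.1 * p.snd.2⟩ : Tot E)

/-- Every point has an open neighborhood over which the fibers are finite-dimensional and mutually
isomorphic as topological algebras. -/
def AlgLocallyHomogeneous : Prop :=
  ∀ x : X, ∃ U : Set X, IsOpen U ∧ x ∈ U ∧ (∀ y ∈ U, FiniteDimensional 𝕜 (E y)) ∧
    ∀ y ∈ U, ∀ z ∈ U, ∃ φ : E y ≃L[𝕜] E z, PreservesMul φ

/-- Local triviality of a Banach-algebra bundle: the model fibers are Banach algebras, and the
local trivializations are multiplicative on fibers. -/
def AlgLocallyTrivial : Prop :=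
  ∀ x : X, ∃ (F : Type v) (_ : NonUnitalNormedRing F) (_ : NormedSpace 𝕜 F)
    (_ : IsScalarTower 𝕜 F F) (_ : SMulCommClass 𝕜 F F) (_ : CompleteSpace F)
    (t : LocalTriv 𝕜 E F), x ∈ t.toTriv.baseSet ∧ ∀ y hy, PreservesMul (t.fiberEquiv y hy)

variable {𝕜 E}

/-- The action is multiplicative on fibers. -/
def BundleAction.IsMultiplicative {G : Type*} [Group G] [TopologicalSpace G] [MulAction G X]
    (α : BundleAction 𝕜 E G) : Prop :=
  ∀ (g : G) (x : X), PreservesMul (α.map g x)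

/-- Equivariant local triviality of a Banach-algebra bundle: the isotropy group acts on the model
Banach algebra by algebra automorphisms. -/
def AlgEquivariantlyLocallyTrivial {G : Type*} [Group G] [TopologicalSpace G] [MulAction G X]
    (α : BundleAction 𝕜 E G) : Prop :=
  ∀ x : X, ∃ (F : Type v) (_ : NonUnitalNormedRing F) (_ : NormedSpace 𝕜 F)
    (_ : IsScalarTower 𝕜 F F) (_ : SMulCommClass 𝕜 F F) (_ : CompleteSpace F)
    (t : LocalTriv 𝕜 E F) (ρ : MulAction.stabilizer G x →* (F ≃L[𝕜] F)),
    t.IsEquivariantAt α x ρ ∧ (∀ y hy, PreservesMul (t.fiberEquiv y hy)) ∧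
      ∀ k, PreservesMul (ρ k)

end Algebra

section CStar

variable {X : Type u} [TopologicalSpace X] (E : X → Type v)
  [∀ x, NonUnitalCStarAlgebra (E x)] [TopologicalSpace (Tot E)]

/-- A continuous Banach-algebra bundle with C⋆-algebra fibers and continuous involution. -/
structure IsCStarBundle : Prop extends IsBanachAlgebraBundle ℂ E where
  continuous_star : Continuous fun p : Tot E => (⟨p.proj, star p.snd⟩ : Tot E)

/-- Every point has an open neighborhood over which the fibers are finite-dimensional and mutually
`⋆`-isomorphic. -/
def CStarLocallyHomogeneous : Prop :=
  ∀ x : X, ∃ U : Set X, IsOpen U ∧ x ∈ U ∧ (∀ y ∈ U, FiniteDimensional ℂ (E y)) ∧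
    ∀ y ∈ U, ∀ z ∈ U, ∃ φ : E y ≃L[ℂ] E z, PreservesMul φ ∧ PreservesStar φ

/-- Local triviality of a C⋆ bundle: the model fibers are C⋆-algebras, and the local trivializations
are `⋆`-isomorphisms on fibers. -/
def CStarLocallyTrivial : Prop :=
  ∀ x : X, ∃ (F : Type v) (_ : NonUnitalCStarAlgebra F) (t : LocalTriv ℂ E F),
    x ∈ t.toTriv.baseSet ∧
      ∀ y hy, PreservesMul (t.fiberEquiv y hy) ∧ PreservesStar (t.fiberEquiv y hy)

variable {E}

/-- The action is by `⋆`-isomorphisms on fibers. -/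
def BundleAction.IsStarMultiplicative {G : Type*} [Group G] [TopologicalSpace G] [MulAction G X]
    (α : BundleAction ℂ E G) : Prop :=
  ∀ (g : G) (x : X), PreservesMul (α.map g x) ∧ PreservesStar (α.map g x)

/-- Equivariant local triviality of a C⋆ bundle: the isotropy group acts on the model C⋆-algebra by
`⋆`-automorphisms. -/
def CStarEquivariantlyLocallyTrivial {G : Type*} [Group G] [TopologicalSpace G] [MulAction G X]
    (α : BundleAction ℂ E G) : Prop :=
  ∀ x : X, ∃ (F : Type v) (_ : NonUnitalCStarAlgebra F) (t : LocalTriv ℂ E F)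
    (ρ : MulAction.stabilizer G x →* (F ≃L[ℂ] F)),
    t.IsEquivariantAt α x ρ ∧
      (∀ y hy, PreservesMul (t.fiberEquiv y hy) ∧ PreservesStar (t.fiberEquiv y hy)) ∧
      ∀ k, PreservesMul (ρ k) ∧ PreservesStar (ρ k)

end CStar

end BanachBundles

/-! The implications (c) ⇒ (b) ⇒ (a) are formal: an equivariant trivialization is a trivialization,
and two fibers over one trivializing set are identified through the model. The content is (a) ⇒ (c),
with `E x` and its isotropy representation as model.

Linear part. A Banach bundle over a paracompact Hausdorff space has enough continuous sections.
Through each vector passes a section continuous at one point (`exists_germ`); partitions of unity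
glue such germs into approximately continuous global sections, and successive improvements converge
uniformly (`exists_section_near`, `exists_section`). Sections through a basis of `E x` give linear
maps from `E x` to the nearby fibers, injective near x by compactness of the unit sphere. Local
constancy of the dimension makes them bijective, with continuous inverse field
(`exists_localFrame`). Haar averaging of the inverse over the compact isotropy group makes it
equivariant and leaves it the identity at x (`exists_equivariantField`); it stays bijective near x
because invertibility is open. This settles Banach and Hilbert bundles.

Multiplicative part. Transporting the products of nearby fibers to `E x` gives a continuous family
of associative products on one finite-dimensional space, close to the product m of `E x`. A
semisimple algebra in characteristic zero is separable, so its second Hochschild cohomology vanishes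
and nearby products are isomorphic to m. Continuity and equivariance require a canonical
isomorphism. The trace form of the regular representation is nondegenerate
(`eq_zero_of_regTraceForm`), and its Casimir element is a separability idempotent invariant under
automorphisms and involutions (`exists_isCasimir`). It provides an explicit contracting homotopy,
hence a Newton-type iteration halving the multiplicativity defect (`norm_defect_add_corr_le`). The
limit depends continuously on the product and is natural (`exists_rigidity`); composing the linear
field with its inverse gives a multiplicative equivariant field (`exists_multiplicative`). For C⋆
bundles the linear field is symmetrized under the involution beforehand. -/

namespace BanachBundles

universe u v w

/-! ### Continuous sections of Banach bundles over paracompact Hausdorff spaces -/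

section Sections

variable {𝕜 : Type*} [RCLike 𝕜] {X : Type*} [TopologicalSpace X] {E : X → Type*}
  [∀ x, NormedAddCommGroup (E x)] [∀ x, NormedSpace 𝕜 (E x)] [TopologicalSpace (Tot E)]

/-- A not necessarily continuous section, as a map into the total space. -/
def sec (s : ∀ y, E y) (y : X) : Tot E := ⟨y, s y⟩

namespace IsBanachBundle

theorem continuousAt_add (h : IsBanachBundle 𝕜 E) {Y : Type*} [TopologicalSpace Y] {f : Y → X}
    {s t : ∀ y, E (f y)} {y₀ : Y} (hs : ContinuousAt (fun y => (⟨f y, s y⟩ : Tot E)) y₀)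
    (ht : ContinuousAt (fun y => (⟨f y, t y⟩ : Tot E)) y₀) :
    ContinuousAt (fun y => (⟨f y, s y + t y⟩ : Tot E)) y₀ := by
  have : ContinuousAt
      (fun y => (⟨f y, (s y, t y)⟩ : TotalSpace (Unit × Unit) (E ×ᵇ E))) y₀ := by
    rw [(FiberBundle.Prod.isInducing_diag Unit E Unit E).continuousAt_iff]
    exact hs.prodMk ht
  exact (h.continuous_add.continuousAt).comp this

theorem continuousAt_smul (h : IsBanachBundle 𝕜 E) {Y : Type*} [TopologicalSpace Y] {f : Y → X}
    {c : Y → 𝕜} {s : ∀ y, E (f y)} {y₀ : Y} (hc : ContinuousAt c y₀)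
    (hs : ContinuousAt (fun y => (⟨f y, s y⟩ : Tot E)) y₀) :
    ContinuousAt (fun y => (⟨f y, c y • s y⟩ : Tot E)) y₀ :=
  ContinuousAt.comp (g := fun p : 𝕜 × Tot E => (⟨p.2.proj, p.1 • p.2.snd⟩ : Tot E))
    h.continuous_smul.continuousAt (hc.prodMk hs)

theorem continuousAt_sub (h : IsBanachBundle 𝕜 E) {Y : Type*} [TopologicalSpace Y] {f : Y → X}
    {s t : ∀ y, E (f y)} {y₀ : Y} (hs : ContinuousAt (fun y => (⟨f y, s y⟩ : Tot E)) y₀)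
    (ht : ContinuousAt (fun y => (⟨f y, t y⟩ : Tot E)) y₀) :
    ContinuousAt (fun y => (⟨f y, s y - t y⟩ : Tot E)) y₀ := by
  have := h.continuousAt_add hs (h.continuousAt_smul (continuousAt_const (y := (-1 : 𝕜))) ht)
  simpa [sub_eq_add_neg] using this

theorem continuousAt_norm (h : IsBanachBundle 𝕜 E) {Y : Type*} [TopologicalSpace Y] {f : Y → X}
    {s : ∀ y, E (f y)} {y₀ : Y} (hs : ContinuousAt (fun y => (⟨f y, s y⟩ : Tot E)) y₀) :
    ContinuousAt (fun y => ‖s y‖) y₀ :=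
  ContinuousAt.comp (g := fun p : Tot E => ‖p.snd‖) h.continuous_norm.continuousAt hs

theorem continuousAt_zero_iff (h : IsBanachBundle 𝕜 E) {Y : Type*} [TopologicalSpace Y] {f : Y → X}
    {s : ∀ y, E (f y)} {y₀ : Y} (hf : ContinuousAt f y₀) (h0 : s y₀ = 0) :
    ContinuousAt (fun y => (⟨f y, s y⟩ : Tot E)) y₀ ↔
      ∀ ε : ℝ, 0 < ε → ∀ᶠ y in 𝓝 y₀, ‖s y‖ < ε := by
  rw [ContinuousAt, h0, (h.nhds_zero_hasBasis (f y₀)).tendsto_right_iff]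
  constructor
  · intro H ε hε
    exact (H (univ, ε) ⟨isOpen_univ, mem_univ _, hε⟩).mono fun y hy => hy.2
  · rintro H ⟨U, ε⟩ ⟨hU, hx, hε⟩
    filter_upwards [H ε hε, hf (hU.mem_nhds hx)] with y h1 h2 using ⟨h2, h1⟩

theorem continuousAt_finset_sum (h : IsBanachBundle 𝕜 E) {Y : Type*} [TopologicalSpace Y]
    {f : Y → X} {y₀ : Y} (hf : ContinuousAt f y₀) {ι : Type*} (I : Finset ι)
    {s : ι → ∀ y, E (f y)}
    (hs : ∀ i ∈ I, ContinuousAt (fun y => (⟨f y, s i y⟩ : Tot E)) y₀) :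
    ContinuousAt (fun y => (⟨f y, ∑ i ∈ I, s i y⟩ : Tot E)) y₀ := by
  classical
  induction I using Finset.induction_on with
  | empty =>
    simp only [Finset.sum_empty]
    rw [h.continuousAt_zero_iff hf rfl]
    intro ε hε
    simp [hε]
  | insert i I hi ih =>
    simp only [Finset.sum_insert hi]
    exact h.continuousAt_add (hs i (by simp)) (ih fun j hj => hs j (by simp [hj]))

/-- The function (a, b) ↦ ‖a - b‖ is continuous on the fiberwise product and vanishes at (v, v). -/
theorem exists_thin (h : IsBanachBundle 𝕜 E) (v : Tot E) {ε : ℝ} (hε : 0 < ε) :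
    ∃ W : Set (Tot E), IsOpen W ∧ v ∈ W ∧
      ∀ y (a b : E y), (⟨y, a⟩ : Tot E) ∈ W → (⟨y, b⟩ : Tot E) ∈ W → ‖a - b‖ < ε := by
  let P := TotalSpace (Unit × Unit) (E ×ᵇ E)
  let q : P := ⟨v.proj, (v.snd, v.snd)⟩
  have hind := FiberBundle.Prod.isInducing_diag Unit E Unit E
  have hc : ContinuousAt (fun p : P => ‖p.snd.1 - p.snd.2‖) q :=
    h.continuousAt_norm (h.continuousAt_sub
      (continuous_fst.comp hind.continuous).continuousAt
      (continuous_snd.comp hind.continuous).continuousAt)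
  have hlt : ∀ᶠ p in 𝓝 q, ‖p.snd.1 - p.snd.2‖ < ε := hc.eventually_lt_const (by simpa [q] using hε)
  rw [hind.nhds_eq_comap, Filter.eventually_comap] at hlt
  rw [nhds_prod_eq] at hlt
  obtain ⟨A, hA, B, hB, hAB⟩ := Filter.eventually_prod_iff.1 hlt
  obtain ⟨W, hW, hWo, hvW⟩ := mem_nhds_iff.1 (Filter.inter_mem hA hB)
  refine ⟨W, hWo, hvW, fun y a b ha hb => ?_⟩
  exact hAB (hW ha).1 (hW hb).2 ⟨y, (a, b)⟩ rfl

/-- Continuity of addition at (v, 0), combined with the prescribed neighborhood base at the zero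
vector. Together with `exists_thin` it lets neighborhoods in the total space be handled by fiberwise
norm estimates. -/
theorem exists_tube (h : IsBanachBundle 𝕜 E) (v : Tot E) {O : Set (Tot E)} (hO : O ∈ 𝓝 v) :
    ∃ W : Set (Tot E), IsOpen W ∧ v ∈ W ∧ ∃ V ∈ 𝓝 v.proj, ∃ ε > 0,
      ∀ y ∈ V, ∀ a b : E y, (⟨y, a⟩ : Tot E) ∈ W → ‖b - a‖ < ε → (⟨y, b⟩ : Tot E) ∈ O := by
  let P := TotalSpace (Unit × Unit) (E ×ᵇ E)
  let q : P := ⟨v.proj, (v.snd, 0)⟩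
  have hind := FiberBundle.Prod.isInducing_diag Unit E Unit E
  have hq : (⟨q.proj, q.snd.1 + q.snd.2⟩ : Tot E) = v := by simp [q]
  have hev : ∀ᶠ p : P in 𝓝 q, (⟨p.proj, p.snd.1 + p.snd.2⟩ : Tot E) ∈ O := by
    have := h.continuous_add.continuousAt (x := q)
    rw [ContinuousAt, hq] at this
    exact this hO
  rw [hind.nhds_eq_comap, Filter.eventually_comap, nhds_prod_eq] at hev
  obtain ⟨A, hA, B, hB, hAB⟩ := Filter.eventually_prod_iff.1 hev
  obtain ⟨W, hW, hWo, hvW⟩ := mem_nhds_iff.1 hA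
  obtain ⟨⟨V, ε⟩, ⟨hV, hxV, hε⟩, hVB⟩ := (h.nhds_zero_hasBasis v.proj).mem_iff.1 hB
  refine ⟨W, hWo, hvW, V, hV.mem_nhds hxV, ε, hε, fun y hy a b ha hb => ?_⟩
  have := hAB (hW ha) (hVB (show (⟨y, b - a⟩ : Tot E) ∈ _ from ⟨hy, hb⟩)) ⟨y, (a, b - a)⟩ rfl
  simpa using this

/-- Through every vector there is a section which is continuous at its base point. -/
theorem exists_germ [∀ x, CompleteSpace (E x)] (h : IsBanachBundle 𝕜 E) (v : Tot E) :
    ∃ s : ∀ y, E y, s v.proj = v.snd ∧ ContinuousAt (sec s) v.proj := by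
  choose W hWo hvW hthin using fun n : ℕ => h.exists_thin v (ε := (1 / 2) ^ n) (by positivity)
  -- A decreasing sequence of open neighborhoods of v whose traces on fibers have diameter at most
  -- 2⁻ⁿ.
  let Z : ℕ → Set (Tot E) := fun n => ⋂ k ∈ Finset.range (n + 1), W k
  have hZo : ∀ n, IsOpen (Z n) := fun n => isOpen_biInter_finset fun k _ => hWo k
  have hZv : ∀ n, v ∈ Z n := fun n => mem_iInter₂.2 fun k _ => hvW k
  have hZa : ∀ {m n}, m ≤ n → Z n ⊆ Z m := fun {m n} hmn p hp => by
    simp only [Z, mem_iInter, Finset.mem_range] at hp ⊢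
    exact fun k hk => hp k (by omega)
  have hZt : ∀ n y (a b : E y), (⟨y, a⟩ : Tot E) ∈ Z n → (⟨y, b⟩ : Tot E) ∈ Z n →
      ‖a - b‖ < (1 / 2) ^ n := fun n y a b ha hb => by
    simp only [Z, mem_iInter, Finset.mem_range] at ha hb
    exact hthin n y a b (ha n (by omega)) (hb n (by omega))
  -- If the fiber over y meets every `Z n`, take the limit of chosen points. Otherwise take a point
  -- of the last `Z n` that it meets, or 0 if it misses already `Z 0`, where nothing is required.
  have key : ∀ y, ∃ a : E y, ∀ n (b : E y), (⟨y, b⟩ : Tot E) ∈ Z n → ‖a - b‖ ≤ (1 / 2) ^ n := by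
    intro y
    by_cases hy : ∀ n, ∃ b : E y, (⟨y, b⟩ : Tot E) ∈ Z n
    · choose c hc using hy
      have hcs : CauchySeq c := by
        refine cauchySeq_of_le_geometric (1 / 2) 1 (by norm_num) fun n => ?_
        rw [dist_eq_norm, one_mul]
        exact (hZt n y _ _ (hc n) (hZa (Nat.le_succ n) (hc (n + 1)))).le
      obtain ⟨a, ha⟩ := cauchySeq_tendsto_of_complete hcs
      refine ⟨a, fun n b hb => ?_⟩
      refine le_of_tendsto (ha.sub_const b).norm ?_
      filter_upwards [Filter.eventually_ge_atTop n] with m hm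
      exact (hZt n y _ _ (hZa hm (hc m)) hb).le
    · push Not at hy
      classical
      have hN := Nat.find_spec hy
      have hlt : ∀ n (b : E y), (⟨y, b⟩ : Tot E) ∈ Z n → n < Nat.find hy := fun n b hb => by
        by_contra hn
        exact hN b (hZa (not_lt.1 hn) hb)
      rcases Nat.eq_zero_or_eq_succ_pred (Nat.find hy) with h0 | h0
      · exact ⟨0, fun n b hb => absurd (hlt n b hb) (by omega)⟩
      · obtain ⟨c, hc⟩ : ∃ c : E y, (⟨y, c⟩ : Tot E) ∈ Z (Nat.find hy).pred := by
          have := Nat.find_min hy (m := (Nat.find hy).pred) (by omega)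
          push Not at this
          exact this
        refine ⟨c, fun n b hb => (hZt n y _ _ (hZa ?_ hc) hb).le⟩
        have := hlt n b hb
        omega
  choose s hs using key
  have hsv : s v.proj = v.snd := by
    rw [← sub_eq_zero, ← norm_le_zero_iff]
    refine ge_of_tendsto' (tendsto_pow_atTop_nhds_zero_of_lt_one (r := (1 / 2 : ℝ))
      (by norm_num) (by norm_num)) fun n => hs _ n _ (hZv n)
  refine ⟨s, hsv, fun O hO => Filter.mem_map.2 ?_⟩
  have : sec s v.proj = v := by simp [sec, hsv]
  rw [this] at hO
  obtain ⟨T, hTo, hvT, V, hV, ε, hε, hT⟩ := h.exists_tube v hO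
  obtain ⟨n, hn⟩ := exists_pow_lt_of_lt_one hε (show (1 / 2 : ℝ) < 1 by norm_num)
  -- Openness of the projection ensures that all fibers near the base point of v meet `T ∩ Z n`; the
  -- section is then 2⁻ⁿ-close to such a point.
  have hopen := h.isOpenMap_proj _ (hTo.inter (hZo n))
  filter_upwards [hV, hopen.mem_nhds ⟨v, ⟨hvT, hZv n⟩, rfl⟩] with y hy hy'
  obtain ⟨⟨y', b⟩, ⟨hb1, hb2⟩, rfl⟩ := hy'
  exact hT _ hy b _ hb1 ((hs _ n b hb2).trans_lt hn)

end IsBanachBundle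

/-- The section `s` is, near `y₀`, within distance `ε` of a section which is continuous at `y₀`. -/
def ApproxContinuousAt (s : ∀ y, E y) (y₀ : X) (ε : ℝ) : Prop :=
  ∃ σ : ∀ y, E y, ContinuousAt (sec σ) y₀ ∧ ∀ᶠ y in 𝓝 y₀, ‖s y - σ y‖ < ε

namespace IsBanachBundle

variable [∀ x, CompleteSpace (E x)]

/-- Compare s with a germ τ through s y₀. An approximant σ is close to τ at y₀, hence near y₀ by
continuity of the norm, so s - τ tends to zero and s = τ + (s - τ) is continuous at y₀. -/
theorem continuousAt_of_approx (h : IsBanachBundle 𝕜 E) {s : ∀ y, E y} {y₀ : X}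
    (hs : ∀ ε, 0 < ε → ApproxContinuousAt s y₀ ε) : ContinuousAt (sec s) y₀ := by
  obtain ⟨τ, hτ, hτc⟩ := h.exists_germ (sec s y₀)
  have hτ : τ y₀ = s y₀ := hτ
  have hτc : ContinuousAt (sec τ) y₀ := hτc
  have hd : ContinuousAt (sec fun y => s y - τ y) y₀ := by
    refine (h.continuousAt_zero_iff (f := id) continuousAt_id (by simp [hτ])).2 fun ε hε => ?_
    obtain ⟨σ, hσ, hσs⟩ := hs (ε / 2) (by linarith)
    have hn := h.continuousAt_norm (f := id) (h.continuousAt_sub (f := id) hσ hτc)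
    have h0 : ‖σ y₀ - τ y₀‖ < ε / 2 := by
      rw [hτ, norm_sub_rev]
      exact hσs.self_of_nhds
    filter_upwards [hσs, hn.eventually_lt_const h0] with y h1 h2
    calc ‖s y - τ y‖ = ‖(s y - σ y) + (σ y - τ y)‖ := by congr 1; abel
      _ ≤ _ := norm_add_le _ _
      _ < ε := by simp only [id] at h2; linarith
  have := h.continuousAt_add (f := id) hτc hd
  simp only [id, add_sub_cancel] at this
  exact this

/-- Continuity at one point propagates approximately: near y₀ the section stays in a thin open set
W, and so does a germ through s y near y. -/
theorem eventually_approx (h : IsBanachBundle 𝕜 E) {s : ∀ y, E y} {y₀ : X}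
    (hs : ContinuousAt (sec s) y₀) {ε : ℝ} (hε : 0 < ε) :
    ∀ᶠ y in 𝓝 y₀, ApproxContinuousAt s y ε := by
  obtain ⟨W, hWo, hW, ht⟩ := h.exists_thin (sec s y₀) hε
  filter_upwards [eventually_eventually_nhds.2 (hs (hWo.mem_nhds hW))] with y hy
  obtain ⟨τ, hτ, hτc⟩ := h.exists_germ (sec s y)
  have hτ : τ y = s y := hτ
  have hτc : ContinuousAt (sec τ) y := hτc
  refine ⟨τ, hτc, ?_⟩
  have hmem : sec τ y ∈ W := by
    have := hy.self_of_nhds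
    simpa [sec, hτ] using this
  filter_upwards [hy, hτc (hWo.mem_nhds hmem)] with z hz1 hz2
  exact ht z _ _ hz1 hz2

theorem norm_sum_smul_le {V : Type*} [NormedAddCommGroup V] [NormedSpace 𝕜 V] {ι : Type*}
    (I : Finset ι) {c : ι → ℝ} {w : ι → V} {ε : ℝ} (hc : ∀ i ∈ I, 0 ≤ c i)
    (h1 : ∑ i ∈ I, c i = 1) (hw : ∀ i ∈ I, c i ≠ 0 → ‖w i‖ ≤ ε) :
    ‖∑ i ∈ I, (c i : 𝕜) • w i‖ ≤ ε := by
  calc ‖∑ i ∈ I, (c i : 𝕜) • w i‖ ≤ ∑ i ∈ I, c i * ε := norm_sum_le_of_le _ fun i hi => by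
        rw [norm_smul, RCLike.norm_ofReal, abs_of_nonneg (hc i hi)]
        by_cases h0 : c i = 0
        · simp [h0]
        · exact mul_le_mul_of_nonneg_left (hw i hi h0) (hc i hi)
    _ = ε := by rw [← Finset.sum_mul, h1, one_mul]

/-- Locally s is ε-close to germs which are themselves almost continuous nearby to any accuracy.
Gluing these germs by a partition of unity improves the accuracy to ε', and convexity keeps the
result within ε of s. -/
theorem exists_better_approx [T2Space X] [ParacompactSpace X] (h : IsBanachBundle 𝕜 E)
    {s : ∀ y, E y} {ε ε' : ℝ} (hs : ∀ y, ApproxContinuousAt s y ε) (hε' : 0 < ε') :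
    ∃ s' : ∀ y, E y, (∀ y, ApproxContinuousAt s' y ε') ∧ ∀ y, ‖s' y - s y‖ ≤ ε := by
  choose σ hσ hσs using hs
  have hU : ∀ x, ∃ U : Set X, IsOpen U ∧ x ∈ U ∧
      ∀ y ∈ U, ‖s y - σ x y‖ < ε ∧ ApproxContinuousAt (σ x) y (ε' / 2) := fun x => by
    obtain ⟨U, hU, hUo, hx⟩ := mem_nhds_iff.1
      ((hσs x).and (h.eventually_approx (hσ x) (half_pos hε')))
    exact ⟨U, hUo, hx, hU⟩
  choose U hUo hxU hU using hU
  obtain ⟨ρ, hρ⟩ := PartitionOfUnity.exists_isSubordinate isClosed_univ U hUo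
    (fun x _ => mem_iUnion.2 ⟨x, hxU x⟩)
  have hsum : ∀ x₀, ∃ I : Finset X, ∀ᶠ y in 𝓝 x₀, ∑ i ∈ I, ρ i y = 1 ∧
      (∑ᶠ i, (ρ i y : 𝕜) • σ i y) = ∑ i ∈ I, (ρ i y : 𝕜) • σ i y := fun x₀ => by
    obtain ⟨I, hI⟩ := ρ.exists_finset_nhds x₀
    refine ⟨I, hI.mono fun y hy => ⟨hy.1, finsum_eq_sum_of_support_subset _ fun i hi => hy.2 ?_⟩⟩
    intro h0
    apply hi
    simp only at h0
    simp [h0]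
  refine ⟨fun y => ∑ᶠ i, (ρ i y : 𝕜) • σ i y, fun x₀ => ?_, fun y => ?_⟩
  · classical
    obtain ⟨I, hI⟩ := hsum x₀
    -- Only indices whose closed support contains x₀ matter near x₀; subordination puts x₀ in their
    -- sets `U i`, so their germs are approximable at x₀.
    let J := I.filter fun i => x₀ ∈ tsupport (ρ i)
    have hJ : ∀ᶠ y in 𝓝 x₀, ∀ i ∈ I, i ∉ J → ρ i y = 0 := by
      rw [Filter.eventually_all_finset]
      intro i hi
      by_cases hx : x₀ ∈ tsupport (ρ i)
      · exact Filter.Eventually.of_forall fun y hy => absurd (Finset.mem_filter.2 ⟨hi, hx⟩) hy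
      · filter_upwards [(isClosed_tsupport (ρ i)).isOpen_compl.mem_nhds hx] with y hy _
        exact image_eq_zero_of_notMem_tsupport hy
    have happ : ∀ i : J, ApproxContinuousAt (σ i) x₀ (ε' / 2) := fun i =>
      (hU i x₀ (hρ i (Finset.mem_filter.1 i.2).2)).2
    choose τ hτ hτs using happ
    refine ⟨fun y => ∑ i : J, (ρ i y : 𝕜) • τ i y, ?_, ?_⟩
    · refine h.continuousAt_finset_sum (f := id) continuousAt_id _ fun i _ => ?_
      exact h.continuousAt_smul (f := id)
        (RCLike.continuous_ofReal.comp (ρ i).continuous).continuousAt (hτ i)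
    · filter_upwards [hI, hJ, Filter.eventually_all.2 hτs] with y h1 h2 h3
      have hs1 : ∑ i ∈ I, ρ i y = ∑ i : J, ρ i y := by
        rw [Finset.univ_eq_attach, Finset.sum_attach J (fun i => ρ i y)]
        exact (Finset.sum_subset (Finset.filter_subset _ _) h2).symm
      have hs2 : ∑ i ∈ I, (ρ i y : 𝕜) • σ i y = ∑ i : J, (ρ i y : 𝕜) • σ i y := by
        rw [Finset.univ_eq_attach, Finset.sum_attach J (fun i => (ρ i y : 𝕜) • σ i y)]
        exact (Finset.sum_subset (Finset.filter_subset _ _)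
          fun i hi hi' => by simp [h2 i hi hi']).symm
      rw [h1.2, hs2, ← Finset.sum_sub_distrib]
      simp only [← smul_sub]
      refine (norm_sum_smul_le _ (fun i _ => ρ.nonneg _ _) (hs1 ▸ h1.1)
        fun i _ _ => (h3 i).le).trans_lt (half_lt_self hε')
  · obtain ⟨I, hI⟩ := hsum y
    obtain ⟨h1, h2⟩ := hI.self_of_nhds
    have : s y = ∑ i ∈ I, (ρ i y : 𝕜) • s y := by
      rw [← Finset.sum_smul, ← RCLike.ofReal_sum, h1, RCLike.ofReal_one, one_smul]
    beta_reduce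
    rw [h2, this, ← Finset.sum_sub_distrib]
    simp only [← smul_sub]
    refine norm_sum_smul_le _ (fun i _ => ρ.nonneg _ _) h1 fun i _ hi => ?_
    rw [norm_sub_rev]
    exact (hU i y (hρ i (subset_tsupport _ hi))).1.le

/-- A germ through v, cut off by a Urysohn function, is a global section with accuracy ε. Repeated
improvement with accuracies ε / 2 ^ n moves it by at most ∑ ε / 2 ^ n = 2ε, and the uniform limit is
continuous. -/
theorem exists_section_near [T2Space X] [ParacompactSpace X] (h : IsBanachBundle 𝕜 E)
    {x : X} (v : E x) {ε : ℝ} (hε : 0 < ε) :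
    ∃ s : ∀ y, E y, Continuous (sec s) ∧ ‖s x - v‖ ≤ ε * 2 := by
  obtain ⟨τ, hτ, hτc⟩ := h.exists_germ (⟨x, v⟩ : Tot E)
  have hτ : τ x = v := hτ
  obtain ⟨C, ⟨hC, hCc⟩, hCs⟩ := (closed_nhds_basis x).mem_iff.1 (h.eventually_approx hτc hε)
  obtain ⟨f, hf0, hf1, hf⟩ := exists_continuous_zero_one_of_isClosed
    (isOpen_interior (s := C)).isClosed_compl (isClosed_singleton (x := x))
    (Set.disjoint_singleton_right.2 fun hx => hx (mem_interior_iff_mem_nhds.2 hC))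
  have h0 : ∀ y, ApproxContinuousAt (fun y => (f y : 𝕜) • τ y) y (ε / 2 ^ 0) := fun y => by
    by_cases hy : y ∈ C
    · obtain ⟨σ, hσ, hσs⟩ := hCs hy
      refine ⟨fun y => (f y : 𝕜) • σ y, h.continuousAt_smul (f := id)
        (RCLike.continuous_ofReal.comp f.continuous).continuousAt hσ, ?_⟩
      filter_upwards [hσs] with z hz
      rw [← smul_sub, norm_smul, RCLike.norm_ofReal, abs_of_nonneg (hf z).1, pow_zero, div_one]
      exact (mul_le_of_le_one_left (norm_nonneg _) (hf z).2).trans_lt hz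
    · refine ⟨fun _ => 0, (h.continuousAt_zero_iff (f := id) continuousAt_id rfl).2
        fun ε hε => by simp [hε], ?_⟩
      filter_upwards [hCc.isOpen_compl.mem_nhds hy] with z hz
      have : f z = 0 := hf0 fun hz' => hz (interior_subset hz')
      simp [this, hε]
  have step : ∀ n, ∀ s : {s : ∀ y, E y // ∀ y, ApproxContinuousAt s y (ε / 2 ^ n)},
      ∃ s' : {s : ∀ y, E y // ∀ y, ApproxContinuousAt s y (ε / 2 ^ (n + 1))},
        ∀ y, ‖s'.1 y - s.1 y‖ ≤ ε / 2 ^ n := fun n s => by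
    obtain ⟨s', h1, h2⟩ := h.exists_better_approx s.2 (ε' := ε / 2 ^ (n + 1)) (by positivity)
    exact ⟨⟨s', h1⟩, h2⟩
  choose F hF using step
  let S : ∀ n, {s : ∀ y, E y // ∀ y, ApproxContinuousAt s y (ε / 2 ^ n)} := fun n =>
    Nat.rec ⟨_, h0⟩ F n
  have hS : ∀ n y, dist ((S n).1 y) ((S (n + 1)).1 y) ≤ ε * 2 / 2 / 2 ^ n := fun n y => by
    rw [dist_eq_norm, norm_sub_rev, mul_div_cancel_right₀ _ (two_ne_zero)]
    exact hF n (S n) y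
  have hlim : ∀ y, ∃ a, Filter.Tendsto (fun n => (S n).1 y) Filter.atTop (𝓝 a) := fun y =>
    cauchySeq_tendsto_of_complete (cauchySeq_of_le_geometric_two fun n => hS n y)
  choose s hs using hlim
  have hd : ∀ n y, ‖(S n).1 y - s y‖ ≤ ε * 2 / 2 ^ n := fun n y => by
    rw [← dist_eq_norm]
    exact dist_le_of_le_geometric_two_of_tendsto (fun n => hS n y) (hs y) n
  refine ⟨s, continuous_iff_continuousAt.2 fun y => h.continuousAt_of_approx fun δ hδ => ?_, ?_⟩
  · obtain ⟨n, hn⟩ := exists_pow_lt_of_lt_one (show 0 < δ / (3 * ε) by positivity)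
      (show (1 / 2 : ℝ) < 1 by norm_num)
    obtain ⟨σ, hσ, hσs⟩ := (S n).2 y
    refine ⟨σ, hσ, ?_⟩
    filter_upwards [hσs] with z hz
    -- The factor 3 collects ε / 2 ^ n for the approximant of `S n` and 2ε / 2 ^ n for the distance
    -- from `S n` to its limit.
    have h3 : 3 * (ε / 2 ^ n) < δ := by
      rw [lt_div_iff₀ (by positivity)] at hn
      calc 3 * (ε / 2 ^ n) = (1 / 2) ^ n * (3 * ε) := by
            rw [one_div, inv_pow]; field_simp
        _ < δ := hn
    calc ‖s z - σ z‖ = ‖(S n).1 z - σ z - ((S n).1 z - s z)‖ := by congr 1; abel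
      _ ≤ ‖(S n).1 z - σ z‖ + ‖(S n).1 z - s z‖ := norm_sub_le _ _
      _ < ε / 2 ^ n + ε * 2 / 2 ^ n := add_lt_add_of_lt_of_le hz (hd n z)
      _ < δ := by rw [mul_div_right_comm]; linarith
  · have := hd 0 x
    have hx : (S 0).1 x = v := by
      change (f x : 𝕜) • τ x = v
      simp [hf1 (mem_singleton x), hτ]
    rwa [hx, norm_sub_rev, pow_zero, div_one] at this

/-- A continuous Banach bundle over a paracompact Hausdorff space has enough continuous sections
(finite-dimensional fibers). -/
theorem exists_section [T2Space X] [ParacompactSpace X] (h : IsBanachBundle 𝕜 E)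
    {x : X} [FiniteDimensional 𝕜 (E x)] (v : E x) :
    ∃ s : ∀ y, E y, Continuous (sec s) ∧ s x = v := by
  let Γ : Submodule 𝕜 (E x) :=
    { carrier := {v | ∃ s : ∀ y, E y, Continuous (sec s) ∧ s x = v}
      add_mem' := by
        rintro _ _ ⟨s, hs, rfl⟩ ⟨t, ht, rfl⟩
        exact ⟨fun y => s y + t y, continuous_iff_continuousAt.2 fun y =>
          h.continuousAt_add (f := id) hs.continuousAt ht.continuousAt, rfl⟩
      zero_mem' := ⟨fun _ => 0, continuous_iff_continuousAt.2 fun y =>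
        (h.continuousAt_zero_iff (f := id) continuousAt_id rfl).2 fun ε hε => by simp [hε], rfl⟩
      smul_mem' := by
        rintro c _ ⟨s, hs, rfl⟩
        exact ⟨fun y => c • s y, continuous_iff_continuousAt.2 fun y =>
          h.continuousAt_smul (f := id) continuousAt_const hs.continuousAt, rfl⟩ }
  -- The values at x of continuous sections form a subspace, dense by `exists_section_near` and
  -- closed by finite dimension.
  have hcl : IsClosed (Γ : Set (E x)) := Submodule.closed_of_finiteDimensional Γ
  have : v ∈ closure (Γ : Set (E x)) := Metric.mem_closure_iff.2 fun ε hε => by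
    obtain ⟨s, hs, hsv⟩ := h.exists_section_near v (show 0 < ε / 4 by linarith)
    refine ⟨s x, ⟨s, hs, rfl⟩, ?_⟩
    rw [dist_comm, dist_eq_norm]
    linarith
  rw [hcl.closure_eq] at this
  exact this

end IsBanachBundle
end Sections
-- Local frames, linear fields and trivializations
section Frames

variable {𝕜 : Type w} [RCLike 𝕜] {X : Type u} [TopologicalSpace X] {E : X → Type v}
  [∀ x, NormedAddCommGroup (E x)] [∀ x, NormedSpace 𝕜 (E x)] [TopologicalSpace (Tot E)]

/-- A family of linear maps from the fibers over `N` to a fixed space is continuous. -/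
def IsFieldOn {A : Type*} [NormedAddCommGroup A] [NormedSpace 𝕜 A] (N : Set X)
    (L : ∀ y, E y →ₗ[𝕜] A) : Prop :=
  ContinuousOn (fun p : Tot E => L p.proj p.snd) (TotalSpace.proj ⁻¹' N)

/-- A family of linear maps from the fiber at `x` to the fibers, which is a continuous
parametrization of the bundle over `N` with continuous inverse `L`. -/
structure LocalFrame (𝕜 : Type w) [RCLike 𝕜] {X : Type u} [TopologicalSpace X] (E : X → Type v)
    [∀ x, NormedAddCommGroup (E x)] [∀ x, NormedSpace 𝕜 (E x)] [TopologicalSpace (Tot E)]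
    (x : X) where
  N : Set X
  isOpen : IsOpen N
  mem : x ∈ N
  S : ∀ y, E x →ₗ[𝕜] E y
  L : ∀ y, E y →ₗ[𝕜] E x
  S_base : ∀ a, S x a = a
  L_S : ∀ y ∈ N, ∀ a, L y (S y a) = a
  S_L : ∀ y ∈ N, ∀ a, S y (L y a) = a
  continuous_S : Continuous fun p : X × E x => (⟨p.1, S p.1 p.2⟩ : Tot E)
  continuousOn_L : IsFieldOn N L

namespace IsBanachBundle

variable [∀ x, CompleteSpace (E x)] [T2Space X] [ParacompactSpace X]

theorem exists_frame (h : IsBanachBundle 𝕜 E) (x : X) [FiniteDimensional 𝕜 (E x)] :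
    ∃ S : ∀ y, E x →ₗ[𝕜] E y, (∀ a, S x a = a) ∧
      Continuous fun p : X × E x => (⟨p.1, S p.1 p.2⟩ : Tot E) := by
  let b := Module.finBasis 𝕜 (E x)
  choose s hs hsx using fun i => h.exists_section (b i)
  refine ⟨fun y => b.constr 𝕜 fun i => s i y, fun a => ?_, ?_⟩
  · simp only [hsx, Module.Basis.constr_apply_fintype]
    exact b.sum_equivFun a
  · simp only [Module.Basis.constr_apply_fintype]
    refine continuous_iff_continuousAt.2 fun p =>
      h.continuousAt_finset_sum continuousAt_fst _ fun i _ => ?_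
    refine h.continuousAt_smul ?_ ((hs i).comp continuous_fst).continuousAt
    have : Continuous b.equivFun := b.equivFunL.continuous
    exact ((continuous_apply i).comp (this.comp continuous_snd)).continuousAt

/-- The frame maps S are the identity at x, so by compactness they have norm above 1/2 on the unit
sphere for y near x. This bound gives injectivity, hence bijectivity by equality of dimensions, and
the estimate ‖a‖ ≤ 2‖S y a‖ behind continuity of the inverse. -/
theorem exists_localFrame (h : IsBanachBundle 𝕜 E) (x : X) [FiniteDimensional 𝕜 (E x)]
    (hdim : ∀ᶠ y in 𝓝 x, FiniteDimensional 𝕜 (E y) ∧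
      Module.finrank 𝕜 (E y) = Module.finrank 𝕜 (E x)) :
    Nonempty (LocalFrame 𝕜 E x) := by
  obtain ⟨S, hSx, hS⟩ := h.exists_frame x
  have : ProperSpace (E x) := FiniteDimensional.proper_rclike 𝕜 (E x)
  have hn : Continuous fun p : X × E x => ‖S p.1 p.2‖ :=
    continuous_iff_continuousAt.2 fun p => h.continuousAt_norm hS.continuousAt
  have hlow : ∀ᶠ y in 𝓝 x, ∀ a ∈ Metric.sphere (0 : E x) 1, 1 / 2 < ‖S y a‖ := by
    refine (isCompact_sphere (0 : E x) 1).eventually_forall_of_forall_eventually fun a ha => ?_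
    refine (hn.tendsto (x, a)).eventually_const_lt ?_
    rw [hSx, mem_sphere_zero_iff_norm.1 ha]
    norm_num
  obtain ⟨N, hN, hNo, hxN⟩ := mem_nhds_iff.1 (hdim.and hlow)
  have hbd : ∀ y ∈ N, ∀ a, ‖a‖ ≤ 2 * ‖S y a‖ := fun y hy a => by
    by_cases ha : a = 0
    · simp [ha]
    have h1 := (hN hy).2 (((‖a‖⁻¹ : ℝ) : 𝕜) • a) (by
      rw [mem_sphere_zero_iff_norm, norm_smul, RCLike.norm_ofReal, abs_of_nonneg (by positivity),
        inv_mul_cancel₀ (norm_ne_zero_iff.2 ha)])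
    rw [map_smul, norm_smul, RCLike.norm_ofReal, abs_of_nonneg (by positivity),
      lt_inv_mul_iff₀ (norm_pos_iff.2 ha)] at h1
    linarith
  have hinj : ∀ y ∈ N, Function.Injective (S y) := fun y hy =>
    (injective_iff_map_eq_zero _).2 fun a ha => by
      have := hbd y hy a
      rw [ha, norm_zero, mul_zero] at this
      exact norm_le_zero_iff.1 this
  have hequiv : ∀ y, ∃ L : E y →ₗ[𝕜] E x,
      y ∈ N → (∀ a, L (S y a) = a) ∧ ∀ a, S y (L a) = a := fun y => by
    by_cases hy : y ∈ N
    · obtain ⟨hfd, hfr⟩ := (hN hy).1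
      let e := LinearEquiv.ofInjectiveOfFinrankEq (S y) (hinj y hy) hfr.symm
      exact ⟨e.symm, fun _ => ⟨fun a => e.symm_apply_apply a, fun a => e.apply_symm_apply a⟩⟩
    · exact ⟨0, fun hy' => absurd hy' hy⟩
  choose L hL using hequiv
  refine ⟨⟨N, hNo, hxN, S, L, hSx, fun y hy => (hL y hy).1, fun y hy => (hL y hy).2, hS, ?_⟩⟩
  rintro ⟨y₀, v₀⟩ hy₀
  have hy₀ : y₀ ∈ N := hy₀
  refine ContinuousAt.continuousWithinAt ?_
  rw [ContinuousAt, tendsto_iff_norm_sub_tendsto_zero]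
  have hpr : ContinuousAt (TotalSpace.proj : Tot E → X) ⟨y₀, v₀⟩ := h.continuous_proj.continuousAt
  -- This function dominates the distance of L p from L v₀ and vanishes at v₀.
  have hd : ContinuousAt (fun p : Tot E => 2 * ‖p.snd - S p.proj (L y₀ v₀)‖) ⟨y₀, v₀⟩ := by
    refine continuousAt_const.mul (h.continuousAt_norm (h.continuousAt_sub continuousAt_id ?_))
    exact ContinuousAt.comp (g := fun p : X × E x => (⟨p.1, S p.1 p.2⟩ : Tot E))
      hS.continuousAt (hpr.prodMk continuousAt_const)
  rw [ContinuousAt] at hd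
  simp only [(hL y₀ hy₀).2, sub_self, norm_zero, mul_zero] at hd
  refine squeeze_zero' (Filter.Eventually.of_forall fun _ => norm_nonneg _) ?_ hd
  filter_upwards [hpr (hNo.mem_nhds hy₀)] with p hp
  refine (hbd p.proj hp _).trans_eq ?_
  rw [map_sub, (hL p.proj hp).2]

end IsBanachBundle

/-- A continuous fiberwise linear bijection onto a product with continuous inverse is a local
trivialization. -/
theorem exists_localTriv_of_inverse (hp : Continuous (TotalSpace.proj : Tot E → X))
    {A : Type v} [NormedAddCommGroup A] [NormedSpace 𝕜 A] [FiniteDimensional 𝕜 A] {N : Set X}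
    (hN : IsOpen N) {L : ∀ y, E y →ₗ[𝕜] A} {R : ∀ y, A →ₗ[𝕜] E y} (hL : IsFieldOn N L)
    (hR : ContinuousOn (fun p : X × A => (⟨p.1, R p.1 p.2⟩ : Tot E)) (N ×ˢ univ))
    (hLR : ∀ y ∈ N, ∀ a, L y (R y a) = a) (hRL : ∀ y ∈ N, ∀ a, R y (L y a) = a) :
    ∃ t : LocalTriv 𝕜 E A, t.toTriv.baseSet = N ∧ ∀ y hy a, t.fiberEquiv y hy a = L y a := by
  let e : ∀ y ∈ N, E y ≃ₗ[𝕜] A := fun y hy =>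
    LinearEquiv.ofLinearMap (L y) (R y) (LinearMap.ext (hLR y hy)) (LinearMap.ext (hRL y hy))
  let T : Trivialization A (TotalSpace.proj : Tot E → X) :=
    { toFun := fun p => (p.proj, L p.proj p.snd)
      invFun := fun p => ⟨p.1, R p.1 p.2⟩
      source := TotalSpace.proj ⁻¹' N
      target := N ×ˢ univ
      map_source' := fun p hp => ⟨hp, mem_univ _⟩
      map_target' := fun p hp => hp.1
      left_inv' := fun p hp => by
        change (⟨p.proj, R p.proj (L p.proj p.snd)⟩ : Tot E) = p
        rw [hRL _ hp]
      right_inv' := fun p hp => by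
        change (p.1, L p.1 (R p.1 p.2)) = p
        rw [hLR _ hp.1]
      open_source := hN.preimage hp
      open_target := hN.prod isOpen_univ
      continuousOn_toFun := hp.continuousOn.prodMk hL
      continuousOn_invFun := hR
      baseSet := N
      open_baseSet := hN
      source_eq := rfl
      target_eq := rfl
      proj_toFun := fun _ _ => rfl }
  refine ⟨⟨T, fun y hy => ?_, ?_⟩, rfl, ?_⟩
  · have : FiniteDimensional 𝕜 (E y) := (e y hy).symm.finiteDimensional
    exact (e y hy).toContinuousLinearEquiv
  · intro y hy a
    rfl
  · intro y hy a
    rfl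

namespace LocalFrame

variable {x : X} [FiniteDimensional 𝕜 (E x)] (fr : LocalFrame 𝕜 E x)

/-- A linear field in the coordinates given by a local frame. -/
noncomputable def coord {A : Type*} [NormedAddCommGroup A] [NormedSpace 𝕜 A]
    (P : ∀ y, E y →ₗ[𝕜] A) (y : X) : E x →L[𝕜] A :=
  LinearMap.toContinuousLinearMap (P y ∘ₗ fr.S y)

theorem continuousOn_coord {A : Type*} [NormedAddCommGroup A] [NormedSpace 𝕜 A]
    {P : ∀ y, E y →ₗ[𝕜] A} {N : Set X} (hP : IsFieldOn N P) :
    ContinuousOn (fr.coord P) N := by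
  refine continuousOn_clm_apply.2 fun a => ?_
  exact ContinuousOn.comp (g := fun p : Tot E => P p.proj p.snd) hP
    (fr.continuous_S.comp (continuous_id.prodMk continuous_const)).continuousOn fun y hy => hy

theorem bijective_iff {P : ∀ y, E y →ₗ[𝕜] E x} {y : X} (hy : y ∈ fr.N) :
    Function.Bijective (P y) ↔ IsUnit (fr.coord P y) := by
  have hS : Function.Bijective (fr.S y) :=
    ⟨Function.LeftInverse.injective (fr.L_S y hy), Function.RightInverse.surjective (fr.S_L y hy)⟩
  rw [← hS.of_comp_iff]
  constructor
  · intro hb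
    let e := (LinearEquiv.ofBijective (P y ∘ₗ fr.S y) hb).toContinuousLinearEquiv
    exact ⟨ContinuousLinearEquiv.toUnit e, by ext; rfl⟩
  · rintro ⟨u, hu⟩
    have : (P y ∘ fr.S y : E x → E x) = ContinuousLinearEquiv.ofUnit u := by
      ext a
      change fr.coord P y a = (u : E x →L[𝕜] E x) a
      rw [hu]
    rw [this]
    exact (ContinuousLinearEquiv.ofUnit u).bijective

/-- In frame coordinates the field is a continuous map into the Banach algebra of endomorphisms of
`E x`, whose units form an open set. -/
theorem isOpen_bijective {P : ∀ y, E y →ₗ[𝕜] E x} {N : Set X} (hN : IsOpen N) (hNf : N ⊆ fr.N)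
    (hP : IsFieldOn N P) : IsOpen {y | y ∈ N ∧ Function.Bijective (P y)} := by
  have : {y | y ∈ N ∧ Function.Bijective (P y)} =
      N ∩ fr.coord P ⁻¹' {u | IsUnit u} := by
    ext y
    exact and_congr_right fun hy => fr.bijective_iff (hNf hy)
  rw [this]
  have : CompleteSpace (E x) := FiniteDimensional.complete 𝕜 _
  exact (fr.continuousOn_coord hP).isOpen_inter_preimage hN Units.isOpen

/-- The inverse is computed in frame coordinates, where inversion is continuous at units, and
carried back by S. -/
theorem exists_inverse {P : ∀ y, E y →ₗ[𝕜] E x} {N : Set X} (hNf : N ⊆ fr.N)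
    (hP : IsFieldOn N P) (hb : ∀ y ∈ N, Function.Bijective (P y)) :
    ∃ R : ∀ y, E x →ₗ[𝕜] E y,
      ContinuousOn (fun p : X × E x => (⟨p.1, R p.1 p.2⟩ : Tot E)) (N ×ˢ univ) ∧
      (∀ y ∈ N, ∀ a, P y (R y a) = a) ∧ ∀ y ∈ N, ∀ a, R y (P y a) = a := by
  have : CompleteSpace (E x) := FiniteDimensional.complete 𝕜 _
  have hu : ∀ y ∈ N, IsUnit (fr.coord P y) := fun y hy => (fr.bijective_iff (hNf hy)).1 (hb y hy)
  have hPR : ∀ y ∈ N, ∀ a, P y (fr.S y (Ring.inverse (fr.coord P y) a)) = a := fun y hy a => by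
    have := DFunLike.congr_fun (Ring.mul_inverse_cancel _ (hu y hy)) a
    exact this
  refine ⟨fun y => fr.S y ∘ₗ (Ring.inverse (fr.coord P y) : E x →L[𝕜] E x), ?_, hPR,
    fun y hy a => (hb y hy).1 (hPR y hy _)⟩
  have hinv : ContinuousOn (fun y => Ring.inverse (fr.coord P y)) N := fun y hy => by
    obtain ⟨u, hu⟩ := hu y hy
    have := NormedRing.inverse_continuousAt u
    rw [hu] at this
    exact this.comp_continuousWithinAt (fr.continuousOn_coord hP y hy)
  have h2 : ContinuousOn (fun p : X × E x => Ring.inverse (fr.coord P p.1) p.2) (N ×ˢ univ) :=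
    (hinv.comp continuousOn_fst fun (p : X × E x) hp => hp.1).clm_apply continuousOn_snd
  exact fr.continuous_S.comp_continuousOn (continuousOn_fst.prodMk h2)

theorem exists_localTriv (hp : Continuous (TotalSpace.proj : Tot E → X))
    {P : ∀ y, E y →ₗ[𝕜] E x} {N : Set X} (hN : IsOpen N)
    (hNf : N ⊆ fr.N) (hP : IsFieldOn N P) (hb : ∀ y ∈ N, Function.Bijective (P y)) :
    ∃ t : LocalTriv 𝕜 E (E x), t.toTriv.baseSet = N ∧ ∀ y hy a, t.fiberEquiv y hy a = P y a := by
  obtain ⟨R, hR, h1, h2⟩ := fr.exists_inverse hNf hP hb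
  exact exists_localTriv_of_inverse hp hN hP hR h1 h2

end LocalFrame

end Frames
-- Isotropy representations and Haar averaging
section Action

variable {𝕜 : Type w} [RCLike 𝕜] {X : Type u} {E : X → Type v}
  [∀ x, NormedAddCommGroup (E x)] [∀ x, NormedSpace 𝕜 (E x)]

/-- Transport of a fiber along an equality of base points. -/
def fiberCast (𝕜 : Type w) [RCLike 𝕜] {X : Type u} {E : X → Type v}
    [∀ x, NormedAddCommGroup (E x)] [∀ x, NormedSpace 𝕜 (E x)] {y z : X} (h : y = z) :
    E y →ₗ[𝕜] E z := by
  subst h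
  exact LinearMap.id

/-- Points such as k • x and x are only propositionally equal, so identities between vectors over
them are stated in the total space, where no transport is visible. -/
theorem mk_fiberCast {y z : X} (h : y = z) (a : E y) :
    (⟨z, fiberCast 𝕜 h a⟩ : Tot E) = ⟨y, a⟩ := by
  subst h
  rfl

variable [TopologicalSpace (Tot E)] {G : Type*} [Group G] [TopologicalSpace G] [MulAction G X]

namespace BundleAction

variable (α : BundleAction 𝕜 E G)

/-- The representation of the isotropy group on the fiber. -/
def rep (x : X) (k : MulAction.stabilizer G x) : E x →ₗ[𝕜] E x :=
  fiberCast 𝕜 (MulAction.mem_stabilizer_iff.1 k.2) ∘ₗ α.map k x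

theorem mk_rep (x : X) (k : MulAction.stabilizer G x) (a : E x) :
    (⟨x, α.rep x k a⟩ : Tot E) = ⟨(k : G) • x, α.map k x a⟩ :=
  mk_fiberCast _ _

theorem mk_map_congr {y z : X} {a : E y} {b : E z} (h : (⟨y, a⟩ : Tot E) = ⟨z, b⟩) (g : G) :
    (⟨g • y, α.map g y a⟩ : Tot E) = ⟨g • z, α.map g z b⟩ :=
  congrArg (fun p : Tot E => (⟨g • p.proj, α.map g p.proj p.snd⟩ : Tot E)) h

theorem rep_one (x : X) (a : E x) : α.rep x 1 a = a :=
  (TotalSpace.mk_inj (F := Unit)).1 ((α.mk_rep x 1 a).trans (α.map_one x a))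

theorem rep_mul (x : X) (k l : MulAction.stabilizer G x) (a : E x) :
    α.rep x (k * l) a = α.rep x k (α.rep x l a) := by
  refine (TotalSpace.mk_inj (F := Unit)).1 ?_
  refine ((α.mk_rep x (k * l) a).trans (α.map_mul k l x a)).trans ?_
  exact ((α.mk_rep x k _).trans (α.mk_map_congr (α.mk_rep x l a) k)).symm

/-- The representation of the isotropy group on a finite-dimensional fiber. -/
noncomputable def repHom (x : X) [FiniteDimensional 𝕜 (E x)] :
    MulAction.stabilizer G x →* (E x ≃L[𝕜] E x) :=
  (ContinuousLinearEquiv.unitsEquiv 𝕜 (E x)).toMonoidHom.comp <| MonoidHom.toHomUnits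
    { toFun := fun k => LinearMap.toContinuousLinearMap (α.rep x k)
      map_one' := ContinuousLinearMap.ext fun a => α.rep_one x a
      map_mul' := fun k l => ContinuousLinearMap.ext fun a => α.rep_mul x k l a }

theorem map_bijective (g : G) (y : X) : Function.Bijective (α.map g y) := by
  constructor
  · intro a b hab
    have h : ∀ c : E y, (⟨g⁻¹ • g • y, α.map g⁻¹ (g • y) (α.map g y c)⟩ : Tot E) = ⟨y, c⟩ :=
      fun c => by
        rw [← α.map_mul]
        exact (congrArg (fun g : G => (⟨g • y, α.map g y c⟩ : Tot E)) (inv_mul_cancel g)).trans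
          (α.map_one y c)
    refine (TotalSpace.mk_inj (F := Unit)).1 ?_
    refine (h a).symm.trans (Eq.trans ?_ (h b))
    rw [hab]
  · intro b
    have h : (⟨g • g⁻¹ • g • y, α.map g (g⁻¹ • g • y) (α.map g⁻¹ (g • y) b)⟩ : Tot E) =
        ⟨g • y, b⟩ := by
      rw [← α.map_mul]
      exact (congrArg (fun h : G => (⟨h • g • y, α.map h (g • y) b⟩ : Tot E))
        (mul_inv_cancel g)).trans (α.map_one _ b)
    refine ⟨fiberCast 𝕜 (inv_smul_smul g y) (α.map g⁻¹ (g • y) b), ?_⟩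
    refine (TotalSpace.mk_inj (F := Unit)).1 ?_
    exact (α.mk_map_congr (mk_fiberCast (inv_smul_smul g y) _) g).trans h

/-- The action is continuous into the total space; a continuous field that is the identity at x
converts this into continuity for the norm topology of the fiber. -/
theorem continuous_rep (x : X) {N : Set X} (hN : x ∈ N) {P : ∀ y, E y →ₗ[𝕜] E x}
    (hP : IsFieldOn N P) (hPx : ∀ a, P x a = a) (hx : Continuous fun a : E x => (⟨x, a⟩ : Tot E)) :
    Continuous fun p : MulAction.stabilizer G x × E x => α.rep x p.1 p.2 := by
  have h1 : Continuous fun p : MulAction.stabilizer G x × E x =>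
      (⟨x, α.rep x p.1 p.2⟩ : Tot E) := by
    simp only [mk_rep]
    exact α.continuous_map.comp
      ((continuous_subtype_val.comp continuous_fst).prodMk (hx.comp continuous_snd))
  refine (hP.comp_continuous h1 fun p => hN).congr fun p => ?_
  exact hPx _

/-- A family of linear maps into the fiber at `x`, over a set invariant under the isotropy group
of `x`, is equivariant. -/
def IsEquivariantField (x : X) (N : Set X) (P : ∀ y, E y →ₗ[𝕜] E x) : Prop :=
  ∀ (k : MulAction.stabilizer G x), ∀ y ∈ N, ∀ a : E y,
    P ((k : G) • y) (α.map k y a) = α.rep x k (P y a)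

end BundleAction

/-- Take the points whose whole orbit under the isotropy group lies in N. The complement is a
projection of a closed set along a compact factor, hence closed. -/
theorem exists_invariant_nhd [TopologicalSpace X] [T2Space X] [CompactSpace G] [ContinuousSMul G X] {x : X} {N : Set X}
    (hN : IsOpen N) (hx : x ∈ N) : ∃ V, IsOpen V ∧ x ∈ V ∧ V ⊆ N ∧
      ∀ k : MulAction.stabilizer G x, ∀ y ∈ V, (k : G) • y ∈ V := by
  have hcl : IsClosed (MulAction.stabilizer G x : Set G) :=
    isClosed_eq (f := fun g : G => g • x) (by fun_prop) continuous_const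
  have : CompactSpace (MulAction.stabilizer G x) := isCompact_iff_compactSpace.1 hcl.isCompact
  refine ⟨{y | ∀ k : MulAction.stabilizer G x, (k : G) • y ∈ N}, ?_, ?_, ?_, ?_⟩
  · have hc : IsClosed (Prod.snd '' {p : MulAction.stabilizer G x × X | (p.1 : G) • p.2 ∈ Nᶜ}) :=
      isClosedMap_snd_of_compactSpace _ (hN.isClosed_compl.preimage (by fun_prop))
    convert hc.isOpen_compl using 1
    ext y
    simp
  · intro k
    rw [MulAction.mem_stabilizer_iff.1 k.2]
    exact hx
  · intro y hy
    simpa using hy 1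
  · intro k y hy l
    have := hy (l * k)
    rwa [Subgroup.coe_mul, mul_smul] at this

open MeasureTheory in
-- Averaging: Q a = ∫ k · P(k⁻¹ a) dk over the isotropy group, which is closed and hence compact.
theorem BundleAction.exists_equivariantField [TopologicalSpace X] [IsTopologicalGroup G] [CompactSpace G] [T2Space G]
    [T2Space X] [ContinuousSMul G X] (α : BundleAction 𝕜 E G) {x : X}
    [FiniteDimensional 𝕜 (E x)] {N : Set X} {P : ∀ y, E y →ₗ[𝕜] E x} (hx : x ∈ N)
    (hN : ∀ k : MulAction.stabilizer G x, ∀ y ∈ N, (k : G) • y ∈ N) (hP : IsFieldOn N P)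
    (hPx : ∀ a, P x a = a) (hc : Continuous fun a : E x => (⟨x, a⟩ : Tot E)) :
    ∃ Q : ∀ y, E y →ₗ[𝕜] E x, IsFieldOn N Q ∧ (∀ a, Q x a = a) ∧ α.IsEquivariantField x N Q := by
  have hcl : IsClosed (MulAction.stabilizer G x : Set G) :=
    isClosed_eq (f := fun g : G => g • x) (by fun_prop) continuous_const
  have : CompactSpace (MulAction.stabilizer G x) := isCompact_iff_compactSpace.1 hcl.isCompact
  have : CompleteSpace (E x) := FiniteDimensional.complete 𝕜 _
  let : MeasurableSpace (MulAction.stabilizer G x) := borel _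
  have : BorelSpace (MulAction.stabilizer G x) := ⟨rfl⟩
  let : NormedSpace ℝ (E x) := NormedSpace.restrictScalars ℝ 𝕜 (E x)
  have : IsScalarTower ℝ 𝕜 (E x) := RestrictScalars.isScalarTower ℝ 𝕜 (E x)
  -- Normalized to total mass one, so that averaging constants changes nothing; this yields Q = id
  -- at x.
  let μ : Measure (MulAction.stabilizer G x) := Measure.haarMeasure ⊤
  have hμ : IsProbabilityMeasure μ := ⟨by
    rw [← TopologicalSpace.PositiveCompacts.coe_top]; exact Measure.haarMeasure_self⟩
  let f : Tot E → MulAction.stabilizer G x → E x := fun p k =>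
    α.rep x k (P ((k⁻¹ : MulAction.stabilizer G x) • p.proj)
      (α.map (k⁻¹ : MulAction.stabilizer G x) p.proj p.snd))
  have hf : ContinuousOn (fun q : Tot E × MulAction.stabilizer G x => f q.1 q.2)
      ((TotalSpace.proj ⁻¹' N) ×ˢ univ) := by
    refine (α.continuous_rep x hx hP hPx hc).comp_continuousOn
      (f := fun q : Tot E × MulAction.stabilizer G x => (q.2, _)) (continuousOn_snd.prodMk ?_)
    refine ContinuousOn.comp (g := fun p : Tot E => P p.proj p.snd) hP (Continuous.continuousOn
      (α.continuous_map.comp (f := fun q : Tot E × MulAction.stabilizer G x =>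
        (((q.2⁻¹ : MulAction.stabilizer G x) : G), q.1)) (by fun_prop))) ?_
    rintro ⟨p, k⟩ ⟨hp, -⟩
    exact hN k⁻¹ _ hp
  have hfc : ∀ y ∈ N, ∀ a : E y, Continuous (f ⟨y, a⟩) := fun y hy a =>
    hf.comp_continuous (f := fun k => ((⟨y, a⟩ : Tot E), k)) (by fun_prop) fun k => ⟨hy, mem_univ _⟩
  have hfi : ∀ y ∈ N, ∀ a : E y, Integrable (f ⟨y, a⟩) μ := fun y hy a =>
    (hfc y hy a).integrable_of_hasCompactSupport (HasCompactSupport.of_compactSpace _)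
  classical
  let Q : ∀ y, E y →ₗ[𝕜] E x := fun y =>
    if hy : y ∈ N then
      { toFun := fun a => ∫ k, f ⟨y, a⟩ k ∂μ
        map_add' := fun a b => by
          rw [← integral_add (hfi y hy a) (hfi y hy b)]
          congr 1
          ext k
          simp [f]
        map_smul' := fun c a => by
          rw [RingHom.id_apply, ← integral_smul]
          congr 1
          ext k
          simp [f] }
    else 0
  have hQ : ∀ y ∈ N, ∀ a : E y, Q y a = ∫ k, f ⟨y, a⟩ k ∂μ := fun y hy a => by
    simp only [Q, dif_pos hy]
    rfl
  refine ⟨Q, ?_, ?_, ?_⟩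
  · have := continuousOn_integral_of_compact_support (μ := μ) (f := f)
      (s := TotalSpace.proj ⁻¹' N) (k := univ) isCompact_univ hf fun p k _ hk => absurd trivial hk
    exact this.congr fun p hp => hQ _ hp _
  · intro a
    rw [hQ x hx]
    have : ∀ k, f ⟨x, a⟩ k = a := fun k => by
      have h1 : P ((k⁻¹ : MulAction.stabilizer G x) • x)
          (α.map (k⁻¹ : MulAction.stabilizer G x) x a) = P x (α.rep x k⁻¹ a) :=
        (congrArg (fun p : Tot E => P p.proj p.snd) (α.mk_rep x k⁻¹ a)).symm
      change α.rep x k (P ((k⁻¹ : MulAction.stabilizer G x) • x)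
          (α.map (k⁻¹ : MulAction.stabilizer G x) x a)) = a
      rw [h1, hPx, ← α.rep_mul, mul_inv_cancel, α.rep_one]
    simp [this]
  · intro k y hy a
    -- Left invariance of Haar measure permits the substitution l ↦ k l, after which k comes out of
    -- the integrand.
    rw [hQ _ (hN k y hy), hQ y hy, ← integral_mul_left_eq_self _ k]
    have h1 : ∀ l, f ⟨(k : G) • y, α.map k y a⟩ (k * l) = α.rep x k (f ⟨y, a⟩ l) := fun l => by
      have h2 : (⟨((k * l)⁻¹ : MulAction.stabilizer G x) • (k : G) • y,
          α.map ((k * l)⁻¹ : MulAction.stabilizer G x) _ (α.map k y a)⟩ : Tot E) =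
          ⟨(l⁻¹ : MulAction.stabilizer G x) • y, α.map (l⁻¹ : MulAction.stabilizer G x) y a⟩ := by
        refine (α.map_mul _ _ _ _).symm.trans ?_
        refine congrArg (fun g : G => (⟨g • y, α.map g y a⟩ : Tot E)) ?_
        simp
      have h3 := congrArg (fun p : Tot E => P p.proj p.snd) h2
      change α.rep x (k * l) (P _ _) = α.rep x k (α.rep x l (P _ _))
      rw [α.rep_mul]
      exact congrArg _ (congrArg _ h3)
    simp only [h1]
    exact (LinearMap.toContinuousLinearMap (α.rep x k)).integral_comp_comm (hfi y hy a)

end Action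
-- The regular trace form and its Casimir element
section TraceForm

open Polynomial in
-- Some polynomial in T is the idempotent that projects onto the Fitting component where T is
-- invertible. It has the form T r(T) T, so its trace vanishes, and in characteristic zero an
-- idempotent of trace zero is zero.
theorem isNilpotent_of_trace_aeval_eq_zero {k V : Type*} [Field k] [CharZero k] [AddCommGroup V]
    [Module k V] [FiniteDimensional k V] (T : Module.End k V)
    (h : ∀ r : k[X], LinearMap.trace k V (T * (aeval T r * T)) = 0) : IsNilpotent T := by
  obtain ⟨n, q, hq, hq0⟩ : ∃ n q, minpoly k T = X ^ n * q ∧ ¬ X ∣ q := by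
    obtain ⟨q, hq, hq0⟩ := Polynomial.exists_eq_pow_rootMultiplicity_mul_and_not_dvd (minpoly k T)
      (minpoly.ne_zero (Algebra.IsIntegral.isIntegral T)) 0
    rw [C_0, sub_zero] at hq hq0
    exact ⟨_, q, hq, hq0⟩
  -- Two factors X beyond the power in the minimal polynomial are reserved for the outer factors T
  -- in the hypothesis.
  have hcop : IsCoprime (X ^ (n + 2)) q :=
    IsCoprime.pow_left ((Polynomial.irreducible_X.coprime_iff_not_dvd).2 hq0)
  obtain ⟨u, v, huv⟩ := hcop
  have hann : aeval T (X ^ n * q) = 0 := by rw [← hq]; exact minpoly.aeval k T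
  have hadd : aeval T (u * X ^ (n + 2)) + aeval T (v * q) = 1 := by
    rw [← map_add, huv, map_one]
  have hmul : aeval T (u * X ^ (n + 2)) * aeval T (v * q) = 0 := by
    rw [← map_mul, show u * X ^ (n + 2) * (v * q) = u * v * X ^ 2 * (X ^ n * q) by ring, map_mul,
      hann, mul_zero]
  have hidem : IsIdempotentElem (aeval T (u * X ^ (n + 2))) := by
    have := congrArg (aeval T (u * X ^ (n + 2)) * ·) hadd
    simp only [mul_add, hmul, add_zero, mul_one] at this
    exact this
  have htr : LinearMap.trace k V (aeval T (u * X ^ (n + 2))) = 0 := by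
    have := h (u * X ^ n)
    have hX : T * (aeval T (u * X ^ n) * T) = aeval T (X * (u * X ^ n * X)) := by
      rw [map_mul (aeval T) X, map_mul (aeval T) (u * X ^ n), aeval_X]
    rwa [hX, show X * (u * X ^ n * X) = u * X ^ (n + 2) by ring] at this
  rw [LinearMap.IsIdempotentElem.trace_eq_zero_iff hidem] at htr
  rw [htr, zero_add] at hadd
  refine ⟨n, ?_⟩
  calc T ^ n = aeval T (X ^ n) * aeval T (v * q) := by rw [hadd]; simp
    _ = aeval T (v * (X ^ n * q)) := by rw [← map_mul]; congr 1; ring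
    _ = 0 := by rw [map_mul, hann, mul_zero]

variable {k A : Type*} [Field k] [AddCommGroup A] [Module k A]

/-- Associativity of a bilinear multiplication. -/
def IsAssocMul (m : A →ₗ[k] A →ₗ[k] A) : Prop := ∀ a b c, m (m a b) c = m a (m b c)

/-- The trace form of the left regular representation. -/
noncomputable def regTraceForm (m : A →ₗ[k] A →ₗ[k] A) : LinearMap.BilinForm k A :=
  m.compr₂ (LinearMap.trace k A ∘ₗ m)

theorem regTraceForm_apply (m : A →ₗ[k] A →ₗ[k] A) (a b : A) :
    regTraceForm m a b = LinearMap.trace k A (m (m a b)) := rfl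

namespace IsAssocMul

variable {m : A →ₗ[k] A →ₗ[k] A} (hm : IsAssocMul m)
include hm

theorem map_mul (a b : A) : m (m a b) = m a * m b := LinearMap.ext fun c => hm a b c

theorem trace_comm (a b : A) :
    LinearMap.trace k A (m (m a b)) = LinearMap.trace k A (m (m b a)) := by
  rw [hm.map_mul, hm.map_mul, LinearMap.trace_mul_comm]

/-- If a is in the radical of the trace form and c = b a, then L_c r(L_c) L_c is left multiplication
by a product that can be cyclically rearranged to end in a, so its trace vanishes. Hence every
L_{ba} is nilpotent. -/
theorem eq_zero_of_regTraceForm [CharZero k] [FiniteDimensional k A]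
    (hs : ∀ a, (∀ b, IsNilpotent (m (m b a))) → a = 0) {a : A}
    (ha : ∀ b, regTraceForm m b a = 0) : a = 0 := by
  refine hs a fun b => isNilpotent_of_trace_aeval_eq_zero _ fun r => ?_
  set c := m b a
  have hr : ∀ z, m (Polynomial.aeval (m c) r z) = Polynomial.aeval (m c) r * m z := by
    induction r using Polynomial.induction_on' with
    | add p q hp hq => intro z; simp [hp, hq, add_mul]
    | monomial n s =>
      intro z
      have hpow : ∀ n : ℕ, m ((m c ^ n) z) = m c ^ n * m z := fun n => by
        induction n with
        | zero => simp
        | succ n ih => rw [pow_succ', Module.End.mul_apply, hm.map_mul, ih, mul_assoc]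
      rw [Polynomial.aeval_monomial]
      simp [Algebra.algebraMap_eq_smul_one, hpow]
  rw [← hr, ← hm.map_mul, hm.trace_comm, ← hm]
  exact ha _

end IsAssocMul

/-- Families dual to each other with respect to a bilinear form. -/
def IsDualPair {ι : Type*} [DecidableEq ι] (B : LinearMap.BilinForm k A) (e f : ι → A) : Prop :=
  ∀ i j, B (e i) (f j) = if i = j then 1 else 0

namespace IsDualPair

variable {ι : Type*} [DecidableEq ι] {B : LinearMap.BilinForm k A} {e f : ι → A}

theorem flip (h : IsDualPair B e f) : IsDualPair B.flip f e := fun i j => by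
  rw [LinearMap.BilinForm.flip_apply, h j i]
  simp [eq_comm]

variable {m : A →ₗ[k] A →ₗ[k] A}

theorem symm (hm : IsAssocMul m) (h : IsDualPair (regTraceForm m) e f) :
    IsDualPair (regTraceForm m) f e := fun i j => by
  rw [regTraceForm_apply, hm.trace_comm, ← regTraceForm_apply, h j i]
  simp [eq_comm]

/-- Left multiplication by g a is the conjugate by g of left multiplication by a, so automorphisms
preserve the trace form. -/
theorem map_equiv (h : IsDualPair (regTraceForm m) e f) (g : A ≃ₗ[k] A)
    (hg : ∀ a b, g (m a b) = m (g a) (g b)) :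
    IsDualPair (regTraceForm m) (g ∘ e) (g ∘ f) := fun i j => by
  have : m (g (m (e i) (f j))) = g.conj (m (m (e i) (f j))) := by
    ext a
    simp [LinearEquiv.conj_apply, hg]
  rw [regTraceForm_apply, Function.comp_apply, Function.comp_apply, ← hg, this,
    LinearMap.trace_conj', ← regTraceForm_apply, h i j]

variable [Fintype ι]

theorem linearIndependent (h : IsDualPair B e f) : LinearIndependent k e := by
  refine Fintype.linearIndependent_iff.2 fun c hc i => ?_
  have := congrArg (fun a => B a (f i)) hc
  simpa [h _ i] using this

theorem sum_left [FiniteDimensional k A] (h : IsDualPair B e f)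
    (hc : Fintype.card ι = Module.finrank k A) (a : A) : ∑ i, B a (f i) • e i = a := by
  rcases isEmpty_or_nonempty ι with hι | hι
  · have : Module.finrank k A = 0 := by rw [← hc, Fintype.card_eq_zero]
    have := Module.finrank_zero_iff.1 this
    exact Subsingleton.elim _ _
  · let b := basisOfLinearIndependentOfCardEqFinrank h.linearIndependent hc
    have hb : ∀ i, b i = e i := fun i => by simp [b]
    have ha := b.sum_repr a
    simp only [hb] at ha
    have hi : ∀ i, B a (f i) = b.repr a i := fun i => by
      conv_lhs => rw [← ha]
      simp [h _ i]
    simp only [hi, ha]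

theorem sum_right [FiniteDimensional k A] (h : IsDualPair B e f)
    (hc : Fintype.card ι = Module.finrank k A) (a : A) : ∑ i, B (e i) a • f i = a := by
  simpa using h.flip.sum_left hc a

/-- The Casimir element of a bilinear form does not depend on the dual pair. -/
theorem sum_eq [FiniteDimensional k A] (h : IsDualPair B e f)
    (hc : Fintype.card ι = Module.finrank k A) {e' f' : ι → A} (h' : IsDualPair B e' f')
    (β : A →ₗ[k] A →ₗ[k] A) : ∑ i, β (e' i) (f' i) = ∑ i, β (e i) (f i) := by
  calc ∑ i, β (e' i) (f' i) = ∑ i, ∑ j, B (e j) (f' i) • β (e' i) (f j) := by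
        refine Finset.sum_congr rfl fun i _ => ?_
        conv_lhs => rw [← h.sum_right hc (f' i)]
        simp
    _ = ∑ j, ∑ i, B (e j) (f' i) • β (e' i) (f j) := Finset.sum_comm
    _ = ∑ j, β (e j) (f j) := by
        refine Finset.sum_congr rfl fun j _ => ?_
        conv_rhs => rw [← h'.sum_left hc (e j)]
        simp

variable [FiniteDimensional k A]

theorem trace_eq (h : IsDualPair B e f) (hc : Fintype.card ι = Module.finrank k A)
    (T : Module.End k A) : LinearMap.trace k A T = ∑ i, B (T (e i)) (f i) := by
  rcases isEmpty_or_nonempty ι with hι | hι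
  · have : Module.finrank k A = 0 := by rw [← hc, Fintype.card_eq_zero]
    have := Module.finrank_zero_iff.1 this
    have hT : T = 0 := LinearMap.ext fun _ => Subsingleton.elim _ _
    simp [hT]
  · let b := basisOfLinearIndependentOfCardEqFinrank h.linearIndependent hc
    have hb : ∀ i, b i = e i := fun i => by simp [b]
    have hi : ∀ a i, B a (f i) = b.repr a i := fun a i => by
      conv_lhs => rw [← b.sum_repr a]
      simp [hb, h _ i]
    rw [LinearMap.trace_eq_matrix_trace k b, Matrix.trace]
    simp [LinearMap.toMatrix_apply, hb, hi]

/-- Expand a eᵢ in the family e and fⱼ a in the family f. The coefficients agree since the form is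
associative and symmetric: B(a eᵢ, fⱼ) = B(eᵢ, fⱼ a). -/
theorem sum_mul_left (hm : IsAssocMul m) (h : IsDualPair (regTraceForm m) e f)
    (hc : Fintype.card ι = Module.finrank k A) (β : A →ₗ[k] A →ₗ[k] A) (a : A) :
    ∑ i, β (m a (e i)) (f i) = ∑ i, β (e i) (m (f i) a) := by
  calc ∑ i, β (m a (e i)) (f i)
      = ∑ i, ∑ j, regTraceForm m (m a (e i)) (f j) • β (e j) (f i) := by
        refine Finset.sum_congr rfl fun i _ => ?_
        conv_lhs => rw [← h.sum_left hc (m a (e i))]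
        simp
    _ = ∑ j, ∑ i, regTraceForm m (m a (e i)) (f j) • β (e j) (f i) := Finset.sum_comm
    _ = ∑ j, β (e j) (m (f j) a) := by
        refine Finset.sum_congr rfl fun j _ => ?_
        conv_rhs => rw [← h.sum_right hc (m (f j) a)]
        rw [map_sum]
        refine Finset.sum_congr rfl fun i _ => ?_
        rw [map_smul, regTraceForm_apply, regTraceForm_apply, ← hm, hm.trace_comm _ a, hm]

/-- Both sides equal ∑ B(a eᵢ, fᵢ), the trace of left multiplication by a in dual bases. With
nondegeneracy this forces ∑ eᵢ fᵢ to be a two-sided unit. -/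
theorem regTraceForm_unit (hm : IsAssocMul m) (h : IsDualPair (regTraceForm m) e f)
    (hc : Fintype.card ι = Module.finrank k A) (a : A) :
    regTraceForm m a (∑ i, m (e i) (f i)) = LinearMap.trace k A (m a) := by
  rw [h.trace_eq hc, map_sum]
  refine Finset.sum_congr rfl fun i _ => ?_
  rw [regTraceForm_apply, regTraceForm_apply, hm]

theorem mul_unit (hm : IsAssocMul m) (hnd : ∀ a, (∀ b, regTraceForm m b a = 0) → a = 0)
    (h : IsDualPair (regTraceForm m) e f) (hc : Fintype.card ι = Module.finrank k A) (a : A) :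
    m a (∑ i, m (e i) (f i)) = a := by
  refine sub_eq_zero.1 (hnd _ fun b => ?_)
  rw [map_sub, sub_eq_zero, regTraceForm_apply, ← hm, ← regTraceForm_apply,
    h.regTraceForm_unit hm hc, regTraceForm_apply]

theorem unit_mul (hm : IsAssocMul m) (hnd : ∀ a, (∀ b, regTraceForm m b a = 0) → a = 0)
    (h : IsDualPair (regTraceForm m) e f) (hc : Fintype.card ι = Module.finrank k A) (a : A) :
    m (∑ i, m (e i) (f i)) a = a := by
  refine sub_eq_zero.1 (hnd _ fun b => ?_)
  rw [map_sub, sub_eq_zero, regTraceForm_apply, ← hm, hm.trace_comm, ← hm, ← regTraceForm_apply,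
    h.regTraceForm_unit hm hc, regTraceForm_apply, hm.trace_comm]

/-- Left and right regular traces agree because the Casimir element is symmetric under e ↔ f. Needed
because an involution exchanges left and right multiplications. -/
theorem trace_flip (hm : IsAssocMul m) (h : IsDualPair (regTraceForm m) e f)
    (hc : Fintype.card ι = Module.finrank k A) (a : A) :
    LinearMap.trace k A (m.flip a) = LinearMap.trace k A (m a) := by
  rw [h.trace_eq hc, ← h.regTraceForm_unit hm hc, ← h.sum_eq hc (h.symm hm) m, map_sum]
  refine Finset.sum_congr rfl fun i _ => ?_
  rw [LinearMap.flip_apply, regTraceForm_apply, regTraceForm_apply, hm, hm.trace_comm, hm]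

end IsDualPair

theorem exists_isDualPair [FiniteDimensional k A] {m : A →ₗ[k] A →ₗ[k] A} (hm : IsAssocMul m)
    (hnd : ∀ a, (∀ b, regTraceForm m b a = 0) → a = 0) :
    ∃ e f : Fin (Module.finrank k A) → A, IsDualPair (regTraceForm m) e f := by
  have hB : (regTraceForm m).Nondegenerate := by
    refine ⟨fun a ha => hnd a fun b => ?_, fun a ha => hnd a ha⟩
    rw [regTraceForm_apply, hm.trace_comm]
    exact ha b
  refine ⟨(regTraceForm m).dualBasis hB (Module.finBasis k A), Module.finBasis k A, fun i j => ?_⟩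
  rw [LinearMap.BilinForm.apply_dualBasis_left]
  simp [eq_comm]

end TraceForm

/-! ### Conjugate-linear involutions and invariance of the Casimir element -/

section Star

variable {𝕜 A : Type*} [RCLike 𝕜] [AddCommGroup A] [Module 𝕜 A] [FiniteDimensional 𝕜 A]

/-- The matrix of S in the basis J b is the complex conjugate of the matrix of T in b. -/
theorem trace_conj_semilinear (J : A →ₗ⋆[𝕜] A) (hJ : ∀ a, J (J a) = a) {S T : Module.End 𝕜 A}
    (hST : ∀ a, S (J a) = J (T a)) :
    LinearMap.trace 𝕜 A S = starRingEnd 𝕜 (LinearMap.trace 𝕜 A T) := by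
  let b := Module.finBasis 𝕜 A
  let b' : Module.Basis _ 𝕜 A := Module.Basis.ofEquivFun
    { toFun := fun a i => starRingEnd 𝕜 (b.repr (J a) i)
      map_add' := fun a a' => by ext; simp
      map_smul' := fun c a => by ext; simp
      invFun := fun c => J (∑ i, starRingEnd 𝕜 (c i) • b i)
      left_inv := fun a => by simp [hJ]
      right_inv := fun c => by ext; simp [hJ, Finsupp.single_apply] }
  have hb' : ∀ i, b' i = J (b i) := fun i => by
    classical
    simp [b', Pi.single_apply]
  have hr : ∀ a i, b'.repr a i = starRingEnd 𝕜 (b.repr (J a) i) := fun a i => rfl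
  rw [LinearMap.trace_eq_matrix_trace 𝕜 b', LinearMap.trace_eq_matrix_trace 𝕜 b, Matrix.trace,
    Matrix.trace, map_sum]
  refine Finset.sum_congr rfl fun i _ => ?_
  simp only [Matrix.diag_apply, LinearMap.toMatrix_apply, hr, hb', hST, hJ]

theorem IsDualPair.map_star {ι : Type*} [DecidableEq ι] [Fintype ι] {m : A →ₗ[𝕜] A →ₗ[𝕜] A}
    {e f : ι → A} (hm : IsAssocMul m) (h : IsDualPair (regTraceForm m) e f)
    (hc : Fintype.card ι = Module.finrank 𝕜 A) (J : A →ₗ⋆[𝕜] A) (hJ : ∀ a, J (J a) = a)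
    (hJm : ∀ a b, J (m a b) = m (J b) (J a)) :
    IsDualPair (regTraceForm m) (J ∘ f) (J ∘ e) := fun i j => by
  have : LinearMap.trace 𝕜 A (m (J (m (e j) (f i)))) =
      starRingEnd 𝕜 (LinearMap.trace 𝕜 A (m.flip (m (e j) (f i)))) :=
    trace_conj_semilinear J hJ fun a => by
      rw [LinearMap.flip_apply]; exact (hJm a _).symm
  rw [regTraceForm_apply, Function.comp_apply, Function.comp_apply, ← hJm, this,
    h.trace_flip hm hc, ← regTraceForm_apply, h j i]
  simp [eq_comm]

/-- The families `e`, `f` represent a separability idempotent `∑ eᵢ ⊗ fᵢ` of the algebra with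
multiplication `m` and unit `u`, which is invariant under all automorphisms and all conjugate-linear
involutions. -/
structure IsCasimir {ι : Type*} [Fintype ι] (m : A →ₗ[𝕜] A →ₗ[𝕜] A) (e f : ι → A) (u : A) :
    Prop where
  unit_mul : ∀ a, m u a = a
  mul_unit : ∀ a, m a u = a
  sum_mul : ∑ i, m (e i) (f i) = u
  sum_mul_left : ∀ (β : A →ₗ[𝕜] A →ₗ[𝕜] A) (a : A),
    ∑ i, β (m a (e i)) (f i) = ∑ i, β (e i) (m (f i) a)
  sum_equiv : ∀ g : A ≃ₗ[𝕜] A, (∀ a b, g (m a b) = m (g a) (g b)) → ∀ β : A →ₗ[𝕜] A →ₗ[𝕜] A,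
    ∑ i, β (g (e i)) (g (f i)) = ∑ i, β (e i) (f i)
  sum_star : ∀ J : A →ₗ⋆[𝕜] A, (∀ a, J (J a) = a) → (∀ a b, J (m a b) = m (J b) (J a)) →
    ∀ β : A →ₗ[𝕜] A →ₗ[𝕜] A, ∑ i, β (J (f i)) (J (e i)) = ∑ i, β (e i) (f i)

theorem exists_isCasimir {m : A →ₗ[𝕜] A →ₗ[𝕜] A} (hm : IsAssocMul m)
    (hs : ∀ a, (∀ b, IsNilpotent (m (m b a))) → a = 0) :
    ∃ (e f : Fin (Module.finrank 𝕜 A) → A) (u : A), IsCasimir m e f u := by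
  have hnd : ∀ a, (∀ b, regTraceForm m b a = 0) → a = 0 := fun a =>
    hm.eq_zero_of_regTraceForm hs
  obtain ⟨e, f, h⟩ := exists_isDualPair hm hnd
  have hc := Fintype.card_fin (Module.finrank 𝕜 A)
  exact ⟨e, f, _, h.unit_mul hm hnd hc, h.mul_unit hm hnd hc, rfl, h.sum_mul_left hm hc,
    fun g hg => h.sum_eq hc (h.map_equiv g hg),
    fun J hJ hJm => h.sum_eq hc (h.map_star hm hc J hJ hJm)⟩

end Star

/-! ### Semisimplicity in terms of nilpotent multiplication operators -/

section Semisimple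

variable {𝕜 A : Type*} [RCLike 𝕜]

/-- If left multiplication by b a is nilpotent, so is b a in the unitization; then 1 + b a is a
unit, which says that b a is quasi-regular. -/
theorem IsJacobsonSemisimple.eq_zero_of_isNilpotent [NonUnitalRing A] [Module 𝕜 A]
    [IsScalarTower 𝕜 A A] [SMulCommClass 𝕜 A A] (h : IsJacobsonSemisimple A) {a : A}
    (ha : ∀ b, IsNilpotent (LinearMap.mul 𝕜 A (b * a))) : a = 0 := by
  refine h a fun b => (isQuasiregular_iff_isUnit' 𝕜).2 (IsNilpotent.isUnit_one_add ?_)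
  obtain ⟨n, hn⟩ := ha b
  refine ⟨n + 1, ?_⟩
  have : ∀ n : ℕ, (((b * a : A) : Unitization 𝕜 A)) ^ (n + 1) =
      ((LinearMap.mul 𝕜 A (b * a) ^ n) (b * a) : A) := fun n => by
    induction n with
    | zero => simp
    | succ n ih => rw [pow_succ', ih, ← Unitization.inr_mul, pow_succ', Module.End.mul_apply,
        LinearMap.mul_apply']
  rw [this, hn]
  simp

/-- The self-adjoint element h = a⋆a is nilpotent. If its least vanishing power were above the
first, the C⋆ identity applied to the preceding power would make that power vanish too. -/
theorem cstar_eq_zero_of_isNilpotent [NonUnitalCStarAlgebra A] {a : A}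
    (ha : ∀ b, IsNilpotent (LinearMap.mul ℂ A (b * a))) : a = 0 := by
  rw [← CStarRing.star_mul_self_eq_zero_iff]
  set h := star a * a
  have hsa : star h = h := by simp [h]
  -- `v n` stands for the power h ^ (n + 1); without a unit there is no zeroth power.
  let v : ℕ → A := fun n => (LinearMap.mul ℂ A h ^ n) h
  have hv : ∀ n, v (n + 1) = h * v n := fun n => by
    simp only [v, pow_succ', Module.End.mul_apply, LinearMap.mul_apply']
  have hv' : ∀ n, v n * h = h * v n := fun n => by
    induction n with
    | zero => simp [v]
    | succ n ih => rw [hv, mul_assoc, ih]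
  have hvs : ∀ n, star (v n) = v n := fun n => by
    induction n with
    | zero => simpa [v] using hsa
    | succ n ih => rw [hv, star_mul, ih, hsa, hv']
  have hvm : ∀ n l, v n * v l = v (n + l + 1) := fun n l => by
    induction n with
    | zero => rw [zero_add, hv]; simp [v]
    | succ n ih => rw [hv, mul_assoc, ih, ← hv]; congr 1; omega
  have hex : ∃ n, v n = 0 := by
    obtain ⟨n, hn⟩ := ha (star a)
    exact ⟨n, by simp only [v, h, hn]; rfl⟩
  classical
  rcases Nat.eq_zero_or_eq_succ_pred (Nat.find hex) with h0 | h0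
  · have := Nat.find_spec hex
    rw [h0] at this
    simpa [v] using this
  · exfalso
    set n := (Nat.find hex).pred
    refine Nat.find_min hex (m := n) (by omega) ?_
    rw [← CStarRing.star_mul_self_eq_zero_iff, hvs, hvm]
    have h1 : v (n + 1) = 0 := by
      have := Nat.find_spec hex
      rwa [h0] at this
    rcases Nat.eq_zero_or_pos n with hn | hn
    · rw [hn] at h1 ⊢; exact h1
    · rw [show n + n + 1 = (n - 1) + (n + 1) + 1 by omega, ← hvm, h1, mul_zero]

end Semisimple

/-! ### Hochschild-type correction of almost multiplicative maps -/

section Rigidity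

variable {𝕜 A : Type*} [RCLike 𝕜] [NormedAddCommGroup A] [NormedSpace 𝕜 A]
  {ι : Type*} [Fintype ι]

/-- The failure of `φ` to be multiplicative from `m` to `n`. -/
noncomputable def defect (m n : A →L[𝕜] A →L[𝕜] A) (φ : A →L[𝕜] A) : A →L[𝕜] A →L[𝕜] A :=
  (ContinuousLinearMap.compL 𝕜 A A A φ).comp m - n.bilinearComp φ φ

theorem defect_apply (m n : A →L[𝕜] A →L[𝕜] A) (φ : A →L[𝕜] A) (a b : A) :
    defect m n φ a b = φ (m a b) - n (φ a) (φ b) := rfl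

/-- The first half of the correction of an almost multiplicative map. -/
noncomputable def corrLeft (m n : A →L[𝕜] A →L[𝕜] A) (e f : ι → A) (φ : A →L[𝕜] A) : A →L[𝕜] A :=
  ∑ i, (n (φ (e i))).comp (defect m n φ (f i))

/-- The second half of the correction of an almost multiplicative map. -/
noncomputable def corrRight (m n : A →L[𝕜] A →L[𝕜] A) (e f : ι → A) (φ : A →L[𝕜] A) :
    A →L[𝕜] A :=
  ∑ i, (n.flip (φ (f i))).comp ((defect m n φ).flip (e i))

theorem corrLeft_apply (m n : A →L[𝕜] A →L[𝕜] A) (e f : ι → A) (φ : A →L[𝕜] A) (a : A) :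
    corrLeft m n e f φ a = ∑ i, n (φ (e i)) (defect m n φ (f i) a) := by
  simp [corrLeft]

theorem corrRight_apply (m n : A →L[𝕜] A →L[𝕜] A) (e f : ι → A) (φ : A →L[𝕜] A) (a : A) :
    corrRight m n e f φ a = ∑ i, n (defect m n φ a (e i)) (φ (f i)) := by
  simp [corrRight]

/-- The correction of an almost multiplicative map. -/
noncomputable def corr (m n : A →L[𝕜] A →L[𝕜] A) (e f : ι → A) (φ : A →L[𝕜] A) : A →L[𝕜] A :=
  (2⁻¹ : 𝕜) • (corrLeft m n e f φ + corrRight m n e f φ)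

theorem corr_apply (m n : A →L[𝕜] A →L[𝕜] A) (e f : ι → A) (φ : A →L[𝕜] A) (a : A) :
    corr m n e f φ a = (2⁻¹ : 𝕜) • (corrLeft m n e f φ a + corrRight m n e f φ a) := rfl

section Identities

variable {m n : A →L[𝕜] A →L[𝕜] A} {e f : ι → A} {u : A}
  (hm : ∀ a b c, m (m a b) c = m a (m b c)) (hn : ∀ a b c, n (n a b) c = n a (n b c))
  (φ : A →L[𝕜] A)

include hm hn in
-- Associativity of m and n makes the defect a Hochschild 2-cocycle for the coefficients twisted by
-- φ, with no error term.
theorem defect_cocycle (a b c : A) :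
    n (φ a) (defect m n φ b c) - defect m n φ (m a b) c + defect m n φ a (m b c) -
      n (defect m n φ a b) (φ c) = 0 := by
  simp only [defect_apply, map_sub, sub_apply, hm, hn]
  abel

theorem sum_mul_map (hC : IsCasimir m.toLinearMap₁₂ e f u) :
    ∑ i, n (φ (e i)) (φ (f i)) = φ u - ∑ i, defect m n φ (e i) (f i) := by
  have hu : φ u = ∑ i, φ (m (e i) (f i)) := by
    rw [← map_sum]
    exact congrArg φ hC.sum_mul.symm
  simp only [defect_apply, Finset.sum_sub_distrib, hu, sub_sub_cancel]

include hm hn in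
-- Contract the cocycle identity at (fᵢ, a, b) with φ(eᵢ) and move a from fᵢ to eᵢ by the
-- separability identity. `corrLeft` is thereby a twisted derivation up to -φ(u)·defect and terms
-- quadratic in the defect.
theorem corrLeft_mul (hC : IsCasimir m.toLinearMap₁₂ e f u) (a b : A) :
    corrLeft m n e f φ (m a b) = n (φ a) (corrLeft m n e f φ b) + n (corrLeft m n e f φ a) (φ b) +
      ∑ i, n (defect m n φ a (e i)) (defect m n φ (f i) b) - n (φ u) (defect m n φ a b) +
      n (∑ i, defect m n φ (e i) (f i)) (defect m n φ a b) := by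
  have h1 : ∀ y, defect m n φ y (m a b) = defect m n φ (m y a) b + n (defect m n φ y a) (φ b) -
      n (φ y) (defect m n φ a b) := fun y => by
    have := defect_cocycle hm hn φ y a b
    rw [← sub_eq_zero, ← this]
    abel
  let β : A →ₗ[𝕜] A →ₗ[𝕜] A := LinearMap.mk₂ 𝕜 (fun x y => n (φ x) (defect m n φ y b))
    (by intros; simp) (by intros; simp) (by intros; simp) (by intros; simp)
  have h2 : ∑ i, n (φ (m a (e i))) (defect m n φ (f i) b) =
      ∑ i, n (φ (e i)) (defect m n φ (m (f i) a) b) := hC.sum_mul_left β a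
  have h3 : ∀ x, φ (m a x) = defect m n φ a x + n (φ a) (φ x) := fun x => by
    rw [defect_apply, sub_add_cancel]
  have h4 : n (φ u) (defect m n φ a b) - n (∑ i, defect m n φ (e i) (f i)) (defect m n φ a b) =
      ∑ i, n (φ (e i)) (n (φ (f i)) (defect m n φ a b)) := by
    rw [← sub_apply, ← map_sub, ← sum_mul_map φ hC]
    simp only [map_sum, sum_apply, hn]
  have h5 : corrLeft m n e f φ (m a b) = ∑ i, n (φ (m a (e i))) (defect m n φ (f i) b) +
      n (corrLeft m n e f φ a) (φ b) -
      ∑ i, n (φ (e i)) (n (φ (f i)) (defect m n φ a b)) := by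
    rw [h2]
    simp only [corrLeft_apply, h1, map_sub, map_add, Finset.sum_add_distrib,
      Finset.sum_sub_distrib, map_sum, sum_apply, hn]
  have h6 : ∑ i, n (φ (m a (e i))) (defect m n φ (f i) b) =
      ∑ i, n (defect m n φ a (e i)) (defect m n φ (f i) b) +
      n (φ a) (corrLeft m n e f φ b) := by
    simp only [h3, map_add, add_apply, hn, Finset.sum_add_distrib,
      corrLeft_apply, map_sum]
  rw [h5, h6, ← h4]
  abel

include hm hn in
theorem corrRight_mul (hC : IsCasimir m.toLinearMap₁₂ e f u) (a b : A) :
    corrRight m n e f φ (m a b) = n (φ a) (corrRight m n e f φ b) +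
      n (corrRight m n e f φ a) (φ b) +
      ∑ i, n (defect m n φ a (e i)) (defect m n φ (f i) b) - n (defect m n φ a b) (φ u) +
      n (defect m n φ a b) (∑ i, defect m n φ (e i) (f i)) := by
  have h1 : ∀ x, defect m n φ (m a b) x = n (φ a) (defect m n φ b x) + defect m n φ a (m b x) -
      n (defect m n φ a b) (φ x) := fun x => by
    have := defect_cocycle hm hn φ a b x
    rw [← sub_eq_zero, ← neg_eq_zero, ← this]
    abel
  let β : A →ₗ[𝕜] A →ₗ[𝕜] A := LinearMap.mk₂ 𝕜 (fun x y => n (defect m n φ a x) (φ y))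
    (by intros; simp) (by intros; simp) (by intros; simp) (by intros; simp)
  have h2 : ∑ i, n (defect m n φ a (m b (e i))) (φ (f i)) =
      ∑ i, n (defect m n φ a (e i)) (φ (m (f i) b)) := hC.sum_mul_left β b
  have h3 : ∀ y, φ (m y b) = defect m n φ y b + n (φ y) (φ b) := fun y => by
    rw [defect_apply, sub_add_cancel]
  have h4 : n (defect m n φ a b) (φ u) - n (defect m n φ a b) (∑ i, defect m n φ (e i) (f i)) =
      ∑ i, n (n (defect m n φ a b) (φ (e i))) (φ (f i)) := by
    rw [← map_sub, ← sum_mul_map φ hC]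
    simp only [map_sum, hn]
  have h5 : corrRight m n e f φ (m a b) = n (φ a) (corrRight m n e f φ b) +
      ∑ i, n (defect m n φ a (m b (e i))) (φ (f i)) -
      ∑ i, n (n (defect m n φ a b) (φ (e i))) (φ (f i)) := by
    simp only [corrRight_apply, h1, map_sub, map_add, add_apply,
      sub_apply, Finset.sum_add_distrib, Finset.sum_sub_distrib, map_sum, hn]
  have h6 : ∑ i, n (defect m n φ a (e i)) (φ (m (f i) b)) =
      ∑ i, n (defect m n φ a (e i)) (defect m n φ (f i) b) +
      n (corrRight m n e f φ a) (φ b) := by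
    simp only [h3, map_add, sum_apply, hn, Finset.sum_add_distrib,
      corrRight_apply, map_sum]
  rw [h5, h2, h6, ← h4]
  abel

include hm hn in
-- The new defect has no bare linear term: what is left of the old one carries a factor 1 - φ(u),
-- small when φ(u) nearly acts as a unit for n, or is quadratic in the defect or the correction.
theorem defect_add_corr (hC : IsCasimir m.toLinearMap₁₂ e f u) (a b : A) :
    defect m n (φ + corr m n e f φ) a b =
      (2⁻¹ : 𝕜) • ((defect m n φ a b - n (φ u) (defect m n φ a b)) +
        (defect m n φ a b - n (defect m n φ a b) (φ u)) +
        (n (∑ i, defect m n φ (e i) (f i)) (defect m n φ a b) +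
          n (defect m n φ a b) (∑ i, defect m n φ (e i) (f i)))) +
      ∑ i, n (defect m n φ a (e i)) (defect m n φ (f i) b) -
      n (corr m n e f φ a) (corr m n e f φ b) := by
  have hc : corr m n e f φ (m a b) = n (φ a) (corr m n e f φ b) + n (corr m n e f φ a) (φ b) +
      ∑ i, n (defect m n φ a (e i)) (defect m n φ (f i) b) +
      (2⁻¹ : 𝕜) • (- n (φ u) (defect m n φ a b) - n (defect m n φ a b) (φ u) +
        (n (∑ i, defect m n φ (e i) (f i)) (defect m n φ a b) +
          n (defect m n φ a b) (∑ i, defect m n φ (e i) (f i)))) := by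
    simp only [corr_apply, corrLeft_mul hm hn φ hC, corrRight_mul hm hn φ hC, map_smul, map_add,
      smul_apply, add_apply]
    module
  rw [defect_apply m n (φ + corr m n e f φ)]
  simp only [add_apply, hc, map_add]
  have hd : defect m n φ a b = φ (m a b) - n (φ a) (φ b) := rfl
  rw [show φ (m a b) = defect m n φ a b + n (φ a) (φ b) by rw [hd]; abel]
  module

end Identities

end Rigidity
-- Convergence of the iteration and the rigidity theorem
section RigidityBounds

variable {𝕜 A : Type*} [RCLike 𝕜] [NormedAddCommGroup A] [NormedSpace 𝕜 A]
  {ι : Type*} [Fintype ι]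

theorem norm_bilin_le (n : A →L[𝕜] A →L[𝕜] A) {M s t : ℝ} (hM : ‖n‖ ≤ M) {a b : A} (ha : ‖a‖ ≤ s)
    (hb : ‖b‖ ≤ t) : ‖n a b‖ ≤ M * s * t := by
  have hM0 := (norm_nonneg n).trans hM
  have hs0 := (norm_nonneg _).trans ha
  calc ‖n a b‖ ≤ ‖n‖ * ‖a‖ * ‖b‖ := n.le_opNorm₂ a b
    _ ≤ M * s * t := by gcongr

theorem norm_half_smul_add_le {a b : A} {s : ℝ} (ha : ‖a‖ ≤ s) (hb : ‖b‖ ≤ s) :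
    ‖(2⁻¹ : 𝕜) • (a + b)‖ ≤ s := by
  rw [norm_smul, norm_inv, RCLike.norm_ofNat]
  linarith [norm_add_le a b]

section

variable {m n : A →L[𝕜] A →L[𝕜] A} {e f : ι → A} {u : A} {φ : A →L[𝕜] A} {M D : ℝ}

theorem norm_corr_le (hM : ‖n‖ ≤ M) (hφ : ‖φ‖ ≤ 2)
    (hδ : ∀ a b, ‖defect m n φ a b‖ ≤ D * ‖a‖ * ‖b‖) (a : A) :
    ‖corr m n e f φ a‖ ≤ 2 * (∑ i, ‖e i‖ * ‖f i‖) * M * D * ‖a‖ := by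
  have hφ' : ∀ x, ‖φ x‖ ≤ 2 * ‖x‖ := fun x => φ.le_of_opNorm_le hφ x
  rw [corr_apply]
  refine norm_half_smul_add_le ?_ ?_
  · rw [corrLeft_apply]
    refine (norm_sum_le_of_le _ fun i _ =>
      norm_bilin_le n hM (hφ' (e i)) (hδ (f i) a)).trans_eq ?_
    simp only [Finset.mul_sum, Finset.sum_mul]
    exact Finset.sum_congr rfl fun i _ => by ring
  · rw [corrRight_apply]
    refine (norm_sum_le_of_le _ fun i _ =>
      norm_bilin_le n hM (hδ a (e i)) (hφ' (f i))).trans_eq ?_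
    simp only [Finset.mul_sum, Finset.sum_mul]
    exact Finset.sum_congr rfl fun i _ => by ring

/-- The unit terms contribute D/4. The quadratic terms contribute (2Mc + 4c²M³)D² with c = ∑
‖eᵢ‖‖fᵢ‖, which `hsmall` bounds by another D/4. -/
theorem norm_defect_add_corr_le (hm : ∀ a b c, m (m a b) c = m a (m b c))
    (hn : ∀ a b c, n (n a b) c = n a (n b c)) (hC : IsCasimir m.toLinearMap₁₂ e f u)
    (hM : ‖n‖ ≤ M) (hφ : ‖φ‖ ≤ 2)
    (hD : 0 ≤ D) (hδ : ∀ a b, ‖defect m n φ a b‖ ≤ D * ‖a‖ * ‖b‖)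
    (h1 : ∀ z, ‖z - n (φ u) z‖ ≤ 1 / 4 * ‖z‖) (h2 : ∀ z, ‖z - n z (φ u)‖ ≤ 1 / 4 * ‖z‖)
    (hsmall : (2 * M * (∑ i, ‖e i‖ * ‖f i‖) + 4 * (∑ i, ‖e i‖ * ‖f i‖) ^ 2 * M ^ 3) * D ≤ 1 / 4)
    (a b : A) : ‖defect m n (φ + corr m n e f φ) a b‖ ≤ D / 2 * ‖a‖ * ‖b‖ := by
  set c := ∑ i, ‖e i‖ * ‖f i‖ with hc
  have hM0 := (norm_nonneg n).trans hM
  have hω : ‖∑ i, defect m n φ (e i) (f i)‖ ≤ D * c := by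
    refine (norm_sum_le_of_le _ fun i _ => hδ (e i) (f i)).trans_eq ?_
    rw [hc, Finset.mul_sum]
    exact Finset.sum_congr rfl fun i _ => by ring
  have hQ : ‖∑ i, n (defect m n φ a (e i)) (defect m n φ (f i) b)‖ ≤
      M * c * D ^ 2 * (‖a‖ * ‖b‖) := by
    refine (norm_sum_le_of_le _ fun i _ =>
      norm_bilin_le n hM (hδ a (e i)) (hδ (f i) b)).trans_eq ?_
    simp only [hc, Finset.mul_sum, Finset.sum_mul]
    exact Finset.sum_congr rfl fun i _ => by ring
  have hη : ‖n (corr m n e f φ a) (corr m n e f φ b)‖ ≤ 4 * c ^ 2 * M ^ 3 * D ^ 2 *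
      (‖a‖ * ‖b‖) :=
    (norm_bilin_le n hM (norm_corr_le hM hφ hδ a) (norm_corr_le hM hφ hδ b)).trans_eq (by ring)
  have hd := hδ a b
  have hA := (h1 (defect m n φ a b)).trans
    (mul_le_mul_of_nonneg_left hd (by norm_num))
  have hB := (h2 (defect m n φ a b)).trans
    (mul_le_mul_of_nonneg_left hd (by norm_num))
  have hω1 := norm_bilin_le n hM hω hd
  have hω2 := norm_bilin_le n hM hd hω
  rw [defect_add_corr hm hn φ hC]
  refine (norm_sub_le_of_le (norm_add_le_of_le (r₁ := (1 / 4 * D + M * c * D ^ 2) *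
    (‖a‖ * ‖b‖)) ?_ hQ) hη).trans ?_
  · rw [norm_smul, norm_inv, RCLike.norm_ofNat]
    have := norm_add_le_of_le (norm_add_le_of_le hA hB) (norm_add_le_of_le hω1 hω2)
    calc _ ≤ (2⁻¹ : ℝ) * _ := mul_le_mul_of_nonneg_left this (by norm_num)
      _ = _ := by ring
  · have hab : 0 ≤ D * (‖a‖ * ‖b‖) := by positivity
    nlinarith [mul_le_mul_of_nonneg_right hsmall hab]

/-- Write z = m u z; the difference splits into the change from m to n and the change from 1 to φ.
-/
theorem norm_sub_unit_mul_le {r ρ : ℝ} (hu : ∀ a, m u a = a) (hM : ‖n‖ ≤ M)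
    (hr : ‖n - m‖ ≤ r) (hρ : ‖φ - 1‖ ≤ ρ) (z : A) :
    ‖z - n (φ u) z‖ ≤ (r * ‖u‖ + M * ρ * ‖u‖) * ‖z‖ := by
  have : z - n (φ u) z = -((n - m) u z + n ((φ - 1) u) z) := by
    simp only [sub_apply, map_sub, hu, one_apply_eq_self]
    abel
  rw [this, norm_neg, add_mul]
  exact norm_add_le_of_le (norm_bilin_le _ hr le_rfl le_rfl)
    ((norm_bilin_le n hM ((φ - 1).le_of_opNorm_le hρ u) le_rfl).trans_eq (by ring))

theorem norm_sub_mul_unit_le {r ρ : ℝ} (hu : ∀ a, m a u = a) (hM : ‖n‖ ≤ M)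
    (hr : ‖n - m‖ ≤ r) (hρ : ‖φ - 1‖ ≤ ρ) (z : A) :
    ‖z - n z (φ u)‖ ≤ (r * ‖u‖ + M * ρ * ‖u‖) * ‖z‖ := by
  have : z - n z (φ u) = -((n - m) z u + n z ((φ - 1) u)) := by
    simp only [sub_apply, map_sub, hu, one_apply_eq_self]
    abel
  rw [this, norm_neg, add_mul]
  exact norm_add_le_of_le ((norm_bilin_le _ hr le_rfl le_rfl).trans_eq (by ring))
    ((norm_bilin_le n hM le_rfl ((φ - 1).le_of_opNorm_le hρ u)).trans_eq (by ring))

end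

/-- The iteration improving the identity to a multiplicative map from `m` to `n`. -/
noncomputable def improve (m n : A →L[𝕜] A →L[𝕜] A) (e f : ι → A) (k : ℕ) : A →L[𝕜] A :=
  Nat.rec 1 (fun _ φ => φ + corr m n e f φ) k

theorem improve_zero (m n : A →L[𝕜] A →L[𝕜] A) (e f : ι → A) : improve m n e f 0 = 1 := rfl

theorem improve_succ (m n : A →L[𝕜] A →L[𝕜] A) (e f : ι → A) (k : ℕ) :
    improve m n e f (k + 1) = improve m n e f k + corr m n e f (improve m n e f k) := rfl

theorem improve_self (m : A →L[𝕜] A →L[𝕜] A) (e f : ι → A) (k : ℕ) : improve m m e f k = 1 := by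
  induction k with
  | zero => rfl
  | succ k ih =>
    have hd : defect m m 1 = 0 := by
      ext a b
      simp [defect_apply]
    rw [improve_succ, ih, add_eq_left]
    ext a
    simp [corr_apply, corrLeft_apply, corrRight_apply, hd]

theorem continuous_improve [FiniteDimensional 𝕜 A] (m : A →L[𝕜] A →L[𝕜] A) (e f : ι → A) (k : ℕ) :
    Continuous fun n => improve m n e f k := by
  induction k with
  | zero => exact continuous_const
  | succ k ih =>
    simp only [improve_succ]
    refine ih.add (continuous_clm_apply.2 fun a => ?_)
    simp only [corr_apply, corrLeft_apply, corrRight_apply, defect_apply]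
    fun_prop

/-- The correction uses e and f only through the Casimir element, which g preserves, so each step
commutes with transport by g. -/
theorem improve_equiv {m n n' : A →L[𝕜] A →L[𝕜] A} {e f : ι → A} {u : A}
    (hC : IsCasimir m.toLinearMap₁₂ e f u) (g : A ≃ₗ[𝕜] A)
    (hg : ∀ a b, g (m a b) = m (g a) (g b)) (hgn : ∀ a b, g (n a b) = n' (g a) (g b)) (k : ℕ)
    (a : A) : improve m n' e f k (g a) = g (improve m n e f k a) := by
  induction k generalizing a with
  | zero => rfl
  | succ k ih =>
    set φ := improve m n e f k
    set φ' := improve m n' e f k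
    have hd : ∀ a b, defect m n' φ' (g a) (g b) = g (defect m n φ a b) := fun a b => by
      rw [defect_apply, defect_apply, ← hg, ih, ih, ih, ← hgn, map_sub]
    let β₁ : A →ₗ[𝕜] A →ₗ[𝕜] A := LinearMap.mk₂ 𝕜 (fun x y => n' (φ' x) (defect m n' φ' y (g a)))
      (by intros; simp) (by intros; simp) (by intros; simp) (by intros; simp)
    let β₂ : A →ₗ[𝕜] A →ₗ[𝕜] A := LinearMap.mk₂ 𝕜 (fun x y => n' (defect m n' φ' (g a) x) (φ' y))
      (by intros; simp) (by intros; simp) (by intros; simp) (by intros; simp)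
    have hL : corrLeft m n' e f φ' (g a) = g (corrLeft m n e f φ a) := by
      rw [corrLeft_apply, corrLeft_apply, map_sum]
      refine (hC.sum_equiv g hg β₁).symm.trans (Finset.sum_congr rfl fun i _ => ?_)
      rw [hgn, ← ih, ← hd]
      rfl
    have hR : corrRight m n' e f φ' (g a) = g (corrRight m n e f φ a) := by
      rw [corrRight_apply, corrRight_apply, map_sum]
      refine (hC.sum_equiv g hg β₂).symm.trans (Finset.sum_congr rfl fun i _ => ?_)
      rw [hgn, ← ih, ← hd]
      rfl
    rw [improve_succ, improve_succ, add_apply, add_apply, map_add, ih, corr_apply, corr_apply,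
      hL, hR, map_smul, map_add]

/-- An involution reverses products and thus exchanges the left and right halves of the correction;
their average commutes with it. -/
theorem improve_star {m n : A →L[𝕜] A →L[𝕜] A} {e f : ι → A} {u : A}
    (hC : IsCasimir m.toLinearMap₁₂ e f u) (J : A →ₗ⋆[𝕜] A) (hJ : ∀ a, J (J a) = a)
    (hJm : ∀ a b, J (m a b) = m (J b) (J a)) (hJn : ∀ a b, J (n a b) = n (J b) (J a)) (k : ℕ)
    (a : A) : improve m n e f k (J a) = J (improve m n e f k a) := by
  induction k generalizing a with
  | zero => rfl
  | succ k ih =>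
    set φ := improve m n e f k
    have hd : ∀ a b, defect m n φ (J a) (J b) = J (defect m n φ b a) := fun a b => by
      rw [defect_apply, defect_apply, ← hJm, ih, ih, ih, ← hJn, map_sub]
    let β₁ : A →ₗ[𝕜] A →ₗ[𝕜] A := LinearMap.mk₂ 𝕜 (fun x y => n (φ x) (defect m n φ y (J a)))
      (by intros; simp) (by intros; simp) (by intros; simp) (by intros; simp)
    let β₂ : A →ₗ[𝕜] A →ₗ[𝕜] A := LinearMap.mk₂ 𝕜 (fun x y => n (defect m n φ (J a) x) (φ y))
      (by intros; simp) (by intros; simp) (by intros; simp) (by intros; simp)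
    have hL : corrLeft m n e f φ (J a) = J (corrRight m n e f φ a) := by
      rw [corrLeft_apply, corrRight_apply, map_sum]
      refine (hC.sum_star J hJ hJm β₁).symm.trans (Finset.sum_congr rfl fun i _ => ?_)
      rw [hJn, ← ih, ← hd]
      rfl
    have hR : corrRight m n e f φ (J a) = J (corrLeft m n e f φ a) := by
      rw [corrLeft_apply, corrRight_apply, map_sum]
      refine (hC.sum_star J hJ hJm β₂).symm.trans (Finset.sum_congr rfl fun i _ => ?_)
      rw [hJn, ← ih, ← hd]
      rfl
    rw [improve_succ, add_apply, add_apply, map_add, ih, corr_apply, corr_apply,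
      hL, hR, map_smulₛₗ, map_inv₀, map_ofNat, map_add,
      add_comm (J (corrRight m n e f φ a))]

/-- Stated as an eventuality so that finitely many smallness conditions on one positive constant can
be met at once. -/
theorem exists_mul_le {K ε : ℝ} (hε : 0 < ε) : ∀ᶠ r in 𝓝[>] (0 : ℝ), K * r ≤ ε := by
  have h : Filter.Tendsto (fun r : ℝ => K * r) (𝓝[>] 0) (𝓝 0) := by
    have : Continuous fun r : ℝ => K * r := by fun_prop
    simpa using (this.tendsto 0).mono_left nhdsWithin_le_nhds
  exact (h.eventually_lt_const hε).mono fun _ => le_of_lt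

/-- Step k moves the map by at most ρ / 2 ^ (k + 1). These moves total less than ρ, so the map stays
ρ-close to 1 and the hypotheses of the halving estimate persist. -/
theorem improve_bounds {m n : A →L[𝕜] A →L[𝕜] A} {e f : ι → A} {u : A} {M r ρ : ℝ}
    (hm : ∀ a b c, m (m a b) c = m a (m b c)) (hn : ∀ a b c, n (n a b) c = n a (n b c))
    (hC : IsCasimir m.toLinearMap₁₂ e f u) (hM : ‖n‖ ≤ M) (hr0 : 0 ≤ r) (hr : ‖n - m‖ ≤ r)
    (hρ0 : 0 ≤ ρ) (hρ1 : ρ ≤ 1) (hu : r * ‖u‖ + M * ρ * ‖u‖ ≤ 1 / 4)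
    (hs1 : (2 * M * (∑ i, ‖e i‖ * ‖f i‖) + 4 * (∑ i, ‖e i‖ * ‖f i‖) ^ 2 * M ^ 3) * r ≤ 1 / 4)
    (hs2 : 2 * (∑ i, ‖e i‖ * ‖f i‖) * M * r ≤ ρ / 2) (k : ℕ) :
    ‖improve m n e f k - 1‖ ≤ ρ * (1 - (1 / 2) ^ k) ∧
      (∀ a b, ‖defect m n (improve m n e f k) a b‖ ≤ r * (1 / 2) ^ k * ‖a‖ * ‖b‖) ∧
      ‖improve m n e f (k + 1) - improve m n e f k‖ ≤ ρ / 2 * (1 / 2) ^ k := by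
  have hM0 := (norm_nonneg n).trans hM
  have key : ∀ k, ‖improve m n e f k - 1‖ ≤ ρ * (1 - (1 / 2) ^ k) →
      (∀ a b, ‖defect m n (improve m n e f k) a b‖ ≤ r * (1 / 2) ^ k * ‖a‖ * ‖b‖) →
      ‖improve m n e f k‖ ≤ 2 ∧
      ‖corr m n e f (improve m n e f k)‖ ≤ ρ / 2 * (1 / 2) ^ k := fun k h1 h2 => by
    have hφ : ‖improve m n e f k‖ ≤ 2 := by
      have h0 : ‖(1 : A →L[𝕜] A)‖ ≤ 1 := ContinuousLinearMap.norm_id_le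
      have h3 : (0 : ℝ) < (1 / 2) ^ k := by positivity
      calc ‖improve m n e f k‖ = ‖(improve m n e f k - 1) + 1‖ := by rw [sub_add_cancel]
        _ ≤ _ := norm_add_le _ _
        _ ≤ 2 := by nlinarith
    refine ⟨hφ, ContinuousLinearMap.opNorm_le_bound _ (by positivity) fun a => ?_⟩
    calc ‖corr m n e f (improve m n e f k) a‖ ≤ _ := norm_corr_le hM hφ h2 a
      _ = (2 * (∑ i, ‖e i‖ * ‖f i‖) * M * r) * ((1 / 2) ^ k * ‖a‖) := by ring
      _ ≤ ρ / 2 * ((1 / 2) ^ k * ‖a‖) := mul_le_mul_of_nonneg_right hs2 (by positivity)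
      _ = _ := by ring
  have main : ‖improve m n e f k - 1‖ ≤ ρ * (1 - (1 / 2) ^ k) ∧
      (∀ a b, ‖defect m n (improve m n e f k) a b‖ ≤ r * (1 / 2) ^ k * ‖a‖ * ‖b‖) := by
    induction k with
    | zero =>
      refine ⟨by simp [improve_zero], fun a b => ?_⟩
      rw [pow_zero, mul_one, defect_apply]
      have : improve m n e f 0 (m a b) - n (improve m n e f 0 a) (improve m n e f 0 b) =
          -((n - m) a b) := by simp [improve_zero]
      rw [this, norm_neg]
      exact norm_bilin_le _ hr le_rfl le_rfl
    | succ k ih =>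
      obtain ⟨h1, h2⟩ := ih
      have hk : (0 : ℝ) < (1 / 2) ^ k := by positivity
      have hk1 : ((1 : ℝ) / 2) ^ k ≤ 1 := pow_le_one₀ (by norm_num) (by norm_num)
      have h1' : ‖improve m n e f k - 1‖ ≤ ρ := h1.trans (by nlinarith)
      obtain ⟨hφ, hη⟩ := key k h1 h2
      constructor
      · rw [improve_succ, add_sub_right_comm]
        refine (norm_add_le_of_le h1 hη).trans_eq ?_
        rw [pow_succ]
        ring
      · intro a b
        have := norm_defect_add_corr_le hm hn hC hM hφ (by positivity) h2
          (fun z => (norm_sub_unit_mul_le hC.unit_mul hM hr h1' z).trans (by gcongr))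
          (fun z => (norm_sub_mul_unit_le hC.mul_unit hM hr h1' z).trans (by gcongr))
          (le_trans (by
            have hc : 0 ≤ ∑ i, ‖e i‖ * ‖f i‖ := by positivity
            gcongr
            exact mul_le_of_le_one_right hr0 hk1) hs1) a b
        rw [improve_succ]
        refine this.trans_eq ?_
        rw [pow_succ]
        ring
  refine ⟨main.1, main.2, ?_⟩
  rw [improve_succ, add_sub_cancel_left]
  exact (key k main.1 main.2).2

theorem exists_isOpen_norm_sub_le {V : Type*} [NormedAddCommGroup V] (m : V) {r : ℝ} (hr : 0 < r) :
    ∃ U : Set V, IsOpen U ∧ m ∈ U ∧ ∀ n ∈ U, ‖n - m‖ ≤ r :=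
  ⟨Metric.ball m r, Metric.isOpen_ball, Metric.mem_ball_self hr,
    fun _ hn => (mem_ball_iff_norm.1 hn).le⟩

/-- Rigidity of associative multiplications with a Casimir element: nearby associative
multiplications are canonically and continuously isomorphic. -/
theorem exists_rigidity [FiniteDimensional 𝕜 A] {m : A →L[𝕜] A →L[𝕜] A}
    (hm : ∀ a b c, m (m a b) c = m a (m b c))
    (hs : ∀ a, (∀ b, IsNilpotent (m (m b a) : A →ₗ[𝕜] A)) → a = 0) :
    ∃ U : Set (A →L[𝕜] A →L[𝕜] A), IsOpen U ∧ m ∈ U ∧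
      ∃ Φ : (A →L[𝕜] A →L[𝕜] A) → (A →L[𝕜] A), Φ m = 1 ∧
        ContinuousOn Φ {n | (∀ a b c, n (n a b) c = n a (n b c)) ∧ n ∈ U} ∧
        ∀ n, (∀ a b c, n (n a b) c = n a (n b c)) → n ∈ U →
          (∀ a b, Φ n (m a b) = n (Φ n a) (Φ n b)) ∧
          (∀ n', (∀ a b c, n' (n' a b) c = n' a (n' b c)) → n' ∈ U → ∀ g : A ≃ₗ[𝕜] A,
            (∀ a b, g (m a b) = m (g a) (g b)) → (∀ a b, g (n a b) = n' (g a) (g b)) →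
            ∀ a, Φ n' (g a) = g (Φ n a)) ∧
          ∀ J : A →ₗ⋆[𝕜] A, Continuous J → (∀ a, J (J a) = a) →
            (∀ a b, J (m a b) = m (J b) (J a)) → (∀ a b, J (n a b) = n (J b) (J a)) →
            ∀ a, Φ n (J a) = J (Φ n a) := by
  have : CompleteSpace A := FiniteDimensional.complete 𝕜 A
  obtain ⟨e, f, u, hC⟩ := exists_isCasimir (m := m.toLinearMap₁₂) hm hs
  -- A common bound for all products n within distance 1 of m.
  set M := ‖m‖ + 1
  set c := ∑ i, ‖e i‖ * ‖f i‖
  -- The radius ρ for the maps is fixed before the radius r for the products, since r has to satisfy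
  -- 2cMr ≤ ρ/2. The two bounds 1/8 add up to the 1/4 allowed for the unit terms.
  obtain ⟨ρ, ⟨hρ1, hρ2⟩, hρ0⟩ := (((exists_mul_le (K := 1) one_pos).and
    (exists_mul_le (K := M * ‖u‖) (show (0 : ℝ) < 1 / 8 by norm_num))).and
    self_mem_nhdsWithin).exists
  have hρ0 : 0 < ρ := hρ0
  obtain ⟨r, ⟨⟨⟨hr1, hr2⟩, hr3⟩, hr4⟩, hr0⟩ := ((((exists_mul_le (K := 1) one_pos).and
    (exists_mul_le (K := ‖u‖) (show (0 : ℝ) < 1 / 8 by norm_num))).and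
    (exists_mul_le (K := 2 * M * c + 4 * c ^ 2 * M ^ 3) (show (0 : ℝ) < 1 / 4 by norm_num))).and
    (exists_mul_le (K := 2 * c * M) (half_pos hρ0))).and self_mem_nhdsWithin |>.exists
  have hr0 : 0 < r := hr0
  have hb : ∀ n : A →L[𝕜] A →L[𝕜] A, (∀ a b c, n (n a b) c = n a (n b c)) → ‖n - m‖ ≤ r →
      ∀ k, (∀ a b, ‖defect m n (improve m n e f k) a b‖ ≤ r * (1 / 2) ^ k * ‖a‖ * ‖b‖) ∧
      ‖improve m n e f (k + 1) - improve m n e f k‖ ≤ ρ / 2 * (1 / 2) ^ k := fun n hn hnr k => by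
    refine (improve_bounds (M := M) hm hn hC ?_ hr0.le hnr hρ0.le (by linarith) (by linarith)
      hr3 hr4 k).2
    calc ‖n‖ = ‖m + (n - m)‖ := by rw [add_sub_cancel]
      _ ≤ ‖m‖ + 1 := (norm_add_le m (n - m)).trans (add_le_add le_rfl (hnr.trans (by linarith)))
  have hsum : Summable fun k : ℕ => ρ / 2 * (1 / 2 : ℝ) ^ k :=
    (summable_geometric_of_lt_one (by norm_num) (by norm_num)).mul_left _
  -- The limit of the iteration as a telescoping series, dominated by a geometric series uniformly
  -- in n; continuity in n follows.
  let Φ : (A →L[𝕜] A →L[𝕜] A) → (A →L[𝕜] A) := fun n =>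
    1 + ∑' k, (improve m n e f (k + 1) - improve m n e f k)
  have hlim : ∀ n : A →L[𝕜] A →L[𝕜] A, (∀ a b c, n (n a b) c = n a (n b c)) → ‖n - m‖ ≤ r →
      Filter.Tendsto (fun k => improve m n e f k) Filter.atTop (𝓝 (Φ n)) := fun n hn hnr => by
    have h1 := (Summable.of_norm_bounded hsum fun k => (hb n hn hnr k).2).hasSum.tendsto_sum_nat
    have h2 := h1.const_add 1
    refine h2.congr fun k => ?_
    rw [Finset.sum_range_sub, improve_zero, add_sub_cancel]
  have hlim' : ∀ n : A →L[𝕜] A →L[𝕜] A, (∀ a b c, n (n a b) c = n a (n b c)) → ‖n - m‖ ≤ r →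
      ∀ a, Filter.Tendsto (fun k => improve m n e f k a) Filter.atTop (𝓝 (Φ n a)) :=
    fun n hn hnr a => ((ContinuousLinearMap.apply 𝕜 A a).continuous.tendsto _).comp
      (hlim n hn hnr)
  obtain ⟨U, hUo, hmU, hU⟩ := exists_isOpen_norm_sub_le m hr0
  refine ⟨U, hUo, hmU, Φ,
    by simp [Φ, improve_self], ?_, fun n hn hnU => ?_⟩
  · refine continuousOn_const.add (continuousOn_tsum (fun k => ?_) hsum fun k n hn =>
      (hb n hn.1 (hU n hn.2) k).2)
    exact ((continuous_improve m e f (k + 1)).sub (continuous_improve m e f k)).continuousOn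
  have hnr := hU n hnU
  refine ⟨fun a b => ?_, ?_, ?_⟩
  · have h1 : Filter.Tendsto (fun k => defect m n (improve m n e f k) a b) Filter.atTop
        (𝓝 (defect m n (Φ n) a b)) := by
      have hcont : Continuous fun φ : A →L[𝕜] A => defect m n φ a b := by
        simp only [defect_apply]
        fun_prop
      exact (hcont.tendsto _).comp (hlim n hn hnr)
    have h2 : Filter.Tendsto (fun k => defect m n (improve m n e f k) a b) Filter.atTop (𝓝 0) := by
      refine squeeze_zero_norm (fun k => (hb n hn hnr k).1 a b) ?_
      have := tendsto_pow_atTop_nhds_zero_of_lt_one (r := (1 / 2 : ℝ)) (by norm_num) (by norm_num)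
      simpa using ((this.const_mul r).mul_const ‖a‖).mul_const ‖b‖
    exact sub_eq_zero.1 (tendsto_nhds_unique h1 h2)
  · intro n' hn' hnU' g hg hgn a
    have hnr' := hU n' hnU'
    have hgc : Continuous g := LinearMap.continuous_of_finiteDimensional (g : A →ₗ[𝕜] A)
    refine tendsto_nhds_unique (hlim' n' hn' hnr' (g a)) ?_
    simp only [improve_equiv hC g hg hgn]
    exact (hgc.tendsto _).comp (hlim' n hn hnr a)
  · intro J hJc hJ hJm hJn a
    refine tendsto_nhds_unique (hlim' n hn hnr (J a)) ?_
    simp only [improve_star hC J hJ hJm hJn]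
    exact (hJc.tendsto _).comp (hlim' n hn hnr a)

end RigidityBounds
-- Equivariant trivializing fields, linear and multiplicative
section Main

variable {𝕜 : Type w} [RCLike 𝕜] {X : Type u} {E : X → Type v}

theorem LocallyHomogeneous.finrank_eq [TopologicalSpace X] [∀ x, NormedAddCommGroup (E x)]
    [∀ x, NormedSpace 𝕜 (E x)] (h : LocallyHomogeneous 𝕜 E) (x : X) :
    FiniteDimensional 𝕜 (E x) ∧ ∀ᶠ y in 𝓝 x, FiniteDimensional 𝕜 (E y) ∧
      Module.finrank 𝕜 (E y) = Module.finrank 𝕜 (E x) := by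
  obtain ⟨U, hU, hx, hfd, hiso⟩ := h x
  refine ⟨hfd x hx, ?_⟩
  filter_upwards [hU.mem_nhds hx] with y hy
  obtain ⟨φ⟩ := hiso y hy x hx
  exact ⟨hfd y hy, φ.toLinearEquiv.finrank_eq⟩

section Banach

variable [∀ x, NormedAddCommGroup (E x)] [∀ x, NormedSpace 𝕜 (E x)] [TopologicalSpace (Tot E)]
  {G : Type*} [Group G] [TopologicalSpace G] [MulAction G X]

theorem BundleAction.rep_bijective (α : BundleAction 𝕜 E G) (x : X)
    (k : MulAction.stabilizer G x) : Function.Bijective (α.rep x k) := by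
  refine Function.bijective_iff_has_inverse.2 ⟨α.rep x k⁻¹, fun a => ?_, fun a => ?_⟩
  · rw [← α.rep_mul, inv_mul_cancel, α.rep_one]
  · rw [← α.rep_mul, mul_inv_cancel, α.rep_one]

theorem BundleAction.IsEquivariantField.bijective {α : BundleAction 𝕜 E G} {x : X} {N : Set X}
    {P : ∀ y, E y →ₗ[𝕜] E x} (hP : α.IsEquivariantField x N P) (k : MulAction.stabilizer G x)
    {y : X} (hy : y ∈ N) (hb : Function.Bijective (P y)) :
    Function.Bijective (P ((k : G) • y)) := by
  rw [← (α.map_bijective k y).of_comp_iff]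
  have : P ((k : G) • y) ∘ α.map k y = α.rep x k ∘ P y := funext (hP k y hy)
  rw [this]
  exact (α.rep_bijective x k).comp hb

variable [TopologicalSpace X]

theorem LocalFrame.L_base {x : X} (fr : LocalFrame 𝕜 E x) (a : E x) : fr.L x a = a := by
  have := fr.L_S x fr.mem a
  rwa [fr.S_base] at this

theorem LocalFrame.continuous_mk {x : X} (fr : LocalFrame 𝕜 E x) :
    Continuous fun a : E x => (⟨x, a⟩ : Tot E) := by
  have := fr.continuous_S.comp (f := fun a : E x => (x, a)) (by fun_prop)
  simpa only [Function.comp_def, fr.S_base] using this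

/-- An equivariant linear field of bijections over an invariant open set. -/
structure IsTrivializingField (α : BundleAction 𝕜 E G) (x : X) (N : Set X)
    (P : ∀ y, E y →ₗ[𝕜] E x) : Prop where
  isOpen : IsOpen N
  mem : x ∈ N
  smul_mem : ∀ (k : MulAction.stabilizer G x), ∀ y ∈ N, (k : G) • y ∈ N
  isFieldOn : IsFieldOn N P
  base : ∀ a, P x a = a
  equivariant : α.IsEquivariantField x N P
  bijective : ∀ y ∈ N, Function.Bijective (P y)

/-- Equivariance conjugates the map at k • y to the map at y, so the open set where the field is
bijective is again invariant. -/
theorem LocalFrame.isTrivializingField {x : X} [FiniteDimensional 𝕜 (E x)]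
    (fr : LocalFrame 𝕜 E x) {α : BundleAction 𝕜 E G} {N : Set X} {P : ∀ y, E y →ₗ[𝕜] E x}
    (hN : IsOpen N) (hNf : N ⊆ fr.N) (hx : x ∈ N)
    (hinv : ∀ (k : MulAction.stabilizer G x), ∀ y ∈ N, (k : G) • y ∈ N) (hP : IsFieldOn N P)
    (hPx : ∀ a, P x a = a) (he : α.IsEquivariantField x N P) :
    IsTrivializingField α x {y | y ∈ N ∧ Function.Bijective (P y)} P where
  isOpen := fr.isOpen_bijective hN hNf hP
  mem := ⟨hx, by
    rw [show ⇑(P x) = id from funext hPx]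
    exact Function.bijective_id⟩
  smul_mem := fun k y hy => ⟨hinv k y hy.1, he.bijective k hy.1 hy.2⟩
  isFieldOn := hP.mono (preimage_mono fun _ hy => hy.1)
  base := hPx
  equivariant := fun k y hy => he k y hy.1
  bijective := fun _ hy => hy.2

theorem IsTrivializingField.exists_localTriv {α : BundleAction 𝕜 E G} {x : X}
    [FiniteDimensional 𝕜 (E x)] {N : Set X} {P : ∀ y, E y →ₗ[𝕜] E x}
    (hp : Continuous (TotalSpace.proj : Tot E → X)) (fr : LocalFrame 𝕜 E x) (hNf : N ⊆ fr.N)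
    (hP : IsTrivializingField α x N P) :
    ∃ t : LocalTriv 𝕜 E (E x), t.IsEquivariantAt α x (α.repHom x) ∧ t.toTriv.baseSet = N ∧
      ∀ y hy a, t.fiberEquiv y hy a = P y a := by
  obtain ⟨t, rfl, ht⟩ := fr.exists_localTriv hp hP.isOpen hNf hP.isFieldOn hP.bijective
  refine ⟨t, ⟨hP.mem, hP.smul_mem, ?_, fun k y hy a => ?_⟩, rfl, ht⟩
  · exact α.continuous_rep x hP.mem hP.isFieldOn hP.base fr.continuous_mk
  · rw [ht, ht]
    exact hP.equivariant k y hy a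

variable [∀ x, CompleteSpace (E x)] [T2Space X] [ParacompactSpace X]
  [IsTopologicalGroup G] [CompactSpace G] [T2Space G] [ContinuousSMul G X]

theorem IsBanachBundle.exists_equivariantField (h : IsBanachBundle 𝕜 E) (α : BundleAction 𝕜 E G)
    (x : X) [FiniteDimensional 𝕜 (E x)] (hdim : ∀ᶠ y in 𝓝 x, FiniteDimensional 𝕜 (E y) ∧
      Module.finrank 𝕜 (E y) = Module.finrank 𝕜 (E x)) :
    ∃ (fr : LocalFrame 𝕜 E x) (N : Set X) (P : ∀ y, E y →ₗ[𝕜] E x), IsOpen N ∧ N ⊆ fr.N ∧ x ∈ N ∧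
      (∀ (k : MulAction.stabilizer G x), ∀ y ∈ N, (k : G) • y ∈ N) ∧ IsFieldOn N P ∧
      (∀ a, P x a = a) ∧ α.IsEquivariantField x N P := by
  obtain ⟨fr⟩ := h.exists_localFrame x hdim
  obtain ⟨N, hN, hxN, hNf, hinv⟩ := exists_invariant_nhd (G := G) fr.isOpen fr.mem
  obtain ⟨P, hP⟩ := α.exists_equivariantField hxN hinv
    (fr.continuousOn_L.mono (preimage_mono hNf)) fr.L_base fr.continuous_mk
  exact ⟨fr, N, P, hN, hNf, hxN, hinv, hP⟩

theorem IsBanachBundle.exists_equivariant_localTriv (h : IsBanachBundle 𝕜 E)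
    (α : BundleAction 𝕜 E G) (hh : LocallyHomogeneous 𝕜 E) (x : X) :
    ∃ (t : LocalTriv 𝕜 E (E x)) (ρ : MulAction.stabilizer G x →* (E x ≃L[𝕜] E x)),
      t.IsEquivariantAt α x ρ := by
  obtain ⟨hfd, hdim⟩ := hh.finrank_eq x
  obtain ⟨fr, N, P, hN, hNf, hx, hinv, hP, hPx, he⟩ := h.exists_equivariantField α x hdim
  obtain ⟨t, ht, -⟩ := (fr.isTrivializingField hN hNf hx hinv hP hPx he).exists_localTriv
    h.continuous_proj fr fun y hy => hNf hy.1
  exact ⟨t, _, ht⟩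

end Banach

theorem locallyHomogeneous_of_localTriv [TopologicalSpace X] [∀ x, NormedAddCommGroup (E x)]
    [∀ x, NormedSpace 𝕜 (E x)] [TopologicalSpace (Tot E)] (hs : Subhomogeneous 𝕜 E)
    (h : ∀ x : X, ∃ (F : Type v) (_ : NormedAddCommGroup F) (_ : NormedSpace 𝕜 F)
      (t : LocalTriv 𝕜 E F), x ∈ t.toTriv.baseSet) : LocallyHomogeneous 𝕜 E := fun x => by
  obtain ⟨F, _, _, t, hx⟩ := h x
  obtain ⟨n, hn⟩ := hs
  exact ⟨t.toTriv.baseSet, t.toTriv.open_baseSet, hx, fun y _ => (hn y).1,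
    fun y hy z hz => ⟨(t.fiberEquiv y hy).trans (t.fiberEquiv z hz).symm⟩⟩

theorem PreservesMul.symm {A B : Type*} [Mul A] [Mul B] {φ : A → B} {ψ : B → A}
    (hφ : PreservesMul φ) (h1 : Function.LeftInverse ψ φ) (h2 : Function.RightInverse ψ φ) :
    PreservesMul ψ := fun a b =>
  h1.injective (by rw [hφ, h2, h2, h2])

theorem PreservesStar.symm {A B : Type*} [Star A] [Star B] {φ : A → B} {ψ : B → A}
    (hφ : PreservesStar φ) (h1 : Function.LeftInverse ψ φ) (h2 : Function.RightInverse ψ φ) :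
    PreservesStar ψ := fun a =>
  h1.injective (by rw [hφ, h2, h2])

theorem fiberCast_mul [∀ x, NonUnitalNormedRing (E x)] [∀ x, NormedSpace 𝕜 (E x)] {y z : X}
    (h : y = z) (a b : E y) : fiberCast 𝕜 h (a * b) = fiberCast 𝕜 h a * fiberCast 𝕜 h b := by
  subst h
  rfl

section Algebra

variable [∀ x, NonUnitalNormedRing (E x)] [∀ x, NormedSpace 𝕜 (E x)]
  [TopologicalSpace (Tot E)] {G : Type*} [Group G] [TopologicalSpace G] [MulAction G X]

theorem BundleAction.IsMultiplicative.rep_mul {α : BundleAction 𝕜 E G} (hα : α.IsMultiplicative)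
    (x : X) (k : MulAction.stabilizer G x) : PreservesMul (α.rep x k) := fun a b => by
  rw [BundleAction.rep, LinearMap.comp_apply, hα, fiberCast_mul]
  rfl

variable [TopologicalSpace X]

theorem IsBanachAlgebraBundle.continuousOn_mul (h : IsBanachAlgebraBundle 𝕜 E) {s t : ∀ y, E y}
    {N : Set X} (hs : ContinuousOn (fun y => (⟨y, s y⟩ : Tot E)) N)
    (ht : ContinuousOn (fun y => (⟨y, t y⟩ : Tot E)) N) :
    ContinuousOn (fun y => (⟨y, s y * t y⟩ : Tot E)) N := by
  have : ContinuousOn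
      (fun y => (⟨y, (s y, t y)⟩ : TotalSpace (Unit × Unit) (E ×ᵇ E))) N := by
    rw [(FiberBundle.Prod.isInducing_diag Unit E Unit E).continuousOn_iff]
    exact hs.prodMk ht
  exact h.continuous_mul.comp_continuousOn this

variable [∀ x, IsScalarTower 𝕜 (E x) (E x)] [∀ x, SMulCommClass 𝕜 (E x) (E x)]

/-- The multiplication of the fiber at `y` transported by `P` and its inverse `R`. -/
noncomputable def transportMul {x : X} [FiniteDimensional 𝕜 (E x)] (P : ∀ y, E y →ₗ[𝕜] E x)
    (R : ∀ y, E x →ₗ[𝕜] E y) (y : X) : E x →L[𝕜] E x →L[𝕜] E x :=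
  (((LinearMap.mul 𝕜 (E y)).compl₁₂ (R y) (R y)).compr₂ (P y)).toContinuousBilinearMap

/-- Transport the fiber products to `E x` through P, apply rigidity at the product of `E x`, and
compose P with the inverse of the resulting isomorphism. Naturality of Φ turns equivariance of P
into equivariance of Q, and likewise for involutions. -/
theorem IsTrivializingField.exists_multiplicative [∀ x, CompleteSpace (E x)]
    [T2Space X] [CompactSpace G] [ContinuousSMul G X]
    {α : BundleAction 𝕜 E G} (hα : α.IsMultiplicative) (h : IsBanachAlgebraBundle 𝕜 E) {x : X}
    [FiniteDimensional 𝕜 (E x)]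
    (hs : ∀ a : E x, (∀ b, IsNilpotent (LinearMap.mul 𝕜 (E x) (b * a))) → a = 0)
    {N : Set X} {P : ∀ y, E y →ₗ[𝕜] E x} (fr : LocalFrame 𝕜 E x) (hNf : N ⊆ fr.N)
    (hP : IsTrivializingField α x N P) :
    ∃ (V : Set X) (Q : ∀ y, E y →ₗ[𝕜] E x), V ⊆ N ∧ IsTrivializingField α x V Q ∧
      (∀ y ∈ V, PreservesMul (Q y)) ∧
      ∀ J : ∀ y, E y →ₗ⋆[𝕜] E y, Continuous (J x) → (∀ y a, J y (J y a) = a) →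
        (∀ y a b, J y (a * b) = J y b * J y a) → (∀ y ∈ N, ∀ a, P y (J y a) = J x (P y a)) →
        ∀ y ∈ V, ∀ a, Q y (J y a) = J x (Q y a) := by
  obtain ⟨R, hR, hPR, hRP⟩ := fr.exists_inverse hNf hP.isFieldOn hP.bijective
  let m := ContinuousLinearMap.mul 𝕜 (E x)
  obtain ⟨U, hUo, hmU, Φ, hΦm, hΦc, hΦ⟩ := exists_rigidity (m := m)
    (fun a b c => mul_assoc a b c) hs
  let μ := transportMul P R
  have hμ : ∀ y a b, μ y a b = P y (R y a * R y b) := fun _ _ _ => rfl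
  have hμc : ContinuousOn μ N := by
    refine continuousOn_clm_apply.2 fun a => continuousOn_clm_apply.2 fun b => ?_
    have hRa : ∀ a, ContinuousOn (fun y => (⟨y, R y a⟩ : Tot E)) N := fun a =>
      hR.comp (f := fun y => (y, a)) (by fun_prop) fun y hy => ⟨hy, mem_univ _⟩
    exact ContinuousOn.comp (g := fun p : Tot E => P p.proj p.snd) hP.isFieldOn
      (h.continuousOn_mul (hRa a) (hRa b)) fun y hy => hy
  have hRx : ∀ a, R x a = a := fun a => by
    have := hPR x hP.mem a
    rwa [hP.base] at this
  have hμx : μ x = m := by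
    ext a b
    rw [hμ, hP.base, hRx, hRx]
    rfl
  have hμa : ∀ y ∈ N, ∀ a b c, μ y (μ y a b) c = μ y a (μ y b c) := fun y hy a b c => by
    simp only [hμ, hRP y hy, mul_assoc]
  -- Restrict first to products close enough for rigidity, then to points where Φ is invertible, and
  -- finally to an invariant neighborhood.
  let N₂ : Set X := N ∩ μ ⁻¹' U
  have hN₂ : IsOpen N₂ := hμc.isOpen_inter_preimage hP.isOpen hUo
  let Ψ : X → (E x →L[𝕜] E x) := fun y => Φ (μ y)
  have hΨc : ContinuousOn Ψ N₂ :=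
    hΦc.comp (hμc.mono inter_subset_left) fun y hy => ⟨hμa y hy.1, hy.2⟩
  let N₃ : Set X := N₂ ∩ Ψ ⁻¹' {u | IsUnit u}
  have hN₃ : IsOpen N₃ := hΨc.isOpen_inter_preimage hN₂ Units.isOpen
  have hΨx : Ψ x = 1 := by simp only [Ψ, hμx, hΦm]
  have hxN₃ : x ∈ N₃ := by
    refine ⟨⟨hP.mem, ?_⟩, ?_⟩
    · rw [mem_preimage, hμx]
      exact hmU
    · rw [mem_preimage, hΨx]
      exact isUnit_one
  obtain ⟨V, hV, hxV, hVN, hinv⟩ := exists_invariant_nhd (G := G) hN₃ hxN₃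
  have hVN' : V ⊆ N := fun y hy => (hVN hy).1.1
  let Q : ∀ y, E y →ₗ[𝕜] E x := fun y => (Ring.inverse (Ψ y) : E x →L[𝕜] E x) ∘ₗ P y
  have hΨQ : ∀ y ∈ V, ∀ a, Ψ y (Q y a) = P y a := fun y hy a =>
    DFunLike.congr_fun (Ring.mul_inverse_cancel _ (hVN hy).2) (P y a)
  have hΨb : ∀ y ∈ V, Function.Bijective (Ψ y) := fun y hy => by
    obtain ⟨w, hw⟩ := (hVN hy).2
    rw [← hw]
    exact (ContinuousLinearEquiv.ofUnit w).bijective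
  have hrig := fun y (hy : y ∈ V) => hΦ (μ y) (hμa y (hVN' hy)) (hVN hy).1.2
  have hΨmul : ∀ y ∈ V, ∀ a b, Ψ y (a * b) = μ y (Ψ y a) (Ψ y b) := fun y hy => (hrig y hy).1
  have hμP : ∀ y ∈ N, ∀ a b, μ y (P y a) (P y b) = P y (a * b) := fun y hy a b => by
    rw [hμ, hRP y hy, hRP y hy]
  refine ⟨V, Q, hVN', ⟨hV, hxV, hinv, ?_, ?_, ?_, ?_⟩, ?_, ?_⟩
  · have hinvc : ContinuousOn (fun y => Ring.inverse (Ψ y)) V := fun y hy => by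
      obtain ⟨w, hw⟩ := (hVN hy).2
      have := NormedRing.inverse_continuousAt w
      rw [hw] at this
      exact this.comp_continuousWithinAt (hΨc.mono (fun y hy => (hVN hy).1) y hy)
    exact (hinvc.comp h.continuous_proj.continuousOn fun (p : Tot E) hp => hp).clm_apply
      (hP.isFieldOn.mono (preimage_mono hVN'))
  · intro a
    change Ring.inverse (Ψ x) (P x a) = a
    rw [hΨx, Ring.inverse_one, hP.base]
    rfl
  · intro k y hy a
    refine (hΨb _ (hinv k y hy)).1 ?_
    rw [hΨQ _ (hinv k y hy), hP.equivariant k y (hVN' hy)]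
    have hk : ∀ b, R ((k : G) • y) (α.rep x k b) = α.map k y (R y b) := fun b => by
      rw [← hRP _ (hVN' (hinv k y hy)) (α.map k y (R y b)), hP.equivariant k y (hVN' hy),
        hPR y (hVN' hy)]
    let g := LinearEquiv.ofBijective (α.rep x k) (α.rep_bijective x k)
    -- Naturality for g the action of k on `E x`: it is an automorphism of m and carries the product
    -- transported from y to the one transported from k • y.
    have := (hrig y hy).2.1 (μ ((k : G) • y)) (hμa _ (hVN' (hinv k y hy)))
      (hVN (hinv k y hy)).1.2 g (hα.rep_mul x k) (fun b c => by
        change α.rep x k (μ y b c) = μ ((k : G) • y) (α.rep x k b) (α.rep x k c)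
        rw [hμ, hμ, ← hP.equivariant k y (hVN' hy), hk, hk]
        exact congrArg _ (hα k y _ _)) (Q y a)
    refine Eq.trans ?_ this.symm
    exact congrArg (α.rep x k) (hΨQ y hy a).symm
  · intro y hy
    have : ⇑(Ψ y) ∘ Q y = P y := funext (hΨQ y hy)
    rw [← (hΨb y hy).of_comp_iff', this]
    exact hP.bijective y (hVN' hy)
  · intro y hy a b
    refine (hΨb y hy).1 ?_
    rw [hΨQ y hy, hΨmul y hy, hΨQ y hy, hΨQ y hy, hμP y (hVN' hy)]
  · intro J hJc hJ hJm hJP y hy a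
    refine (hΨb y hy).1 ?_
    have hJR : ∀ a, R y (J x a) = J y (R y a) := fun a => by
      rw [← hRP y (hVN' hy) (J y (R y a)), hJP y (hVN' hy), hPR y (hVN' hy)]
    have := (hrig y hy).2.2 (J x) hJc (hJ x) (hJm x) (fun b c => by
      rw [hμ, hμ, ← hJP y (hVN' hy), hJm, hJR, hJR]) (Q y a)
    rw [hΨQ y hy, hJP y (hVN' hy)]
    refine Eq.trans ?_ this.symm
    rw [← hΨQ y hy a]

end Algebra

end Main
-- Banach-algebra bundles
section AlgebraMain

variable {𝕜 : Type w} [RCLike 𝕜] {X : Type u} [TopologicalSpace X] {E : X → Type v}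
  [∀ x, NonUnitalNormedRing (E x)] [∀ x, NormedSpace 𝕜 (E x)]

theorem AlgLocallyHomogeneous.locallyHomogeneous (h : AlgLocallyHomogeneous 𝕜 E) :
    LocallyHomogeneous 𝕜 E := fun x => by
  obtain ⟨U, hU, hx, hfd, hiso⟩ := h x
  exact ⟨U, hU, hx, hfd, fun y hy z hz => ⟨(hiso y hy z hz).choose⟩⟩

variable [TopologicalSpace (Tot E)]

theorem AlgLocallyTrivial.algLocallyHomogeneous (hs : Subhomogeneous 𝕜 E)
    (h : AlgLocallyTrivial 𝕜 E) : AlgLocallyHomogeneous 𝕜 E := fun x => by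
  obtain ⟨F, _, _, _, _, _, t, hx, ht⟩ := h x
  obtain ⟨n, hn⟩ := hs
  refine ⟨t.toTriv.baseSet, t.toTriv.open_baseSet, hx, fun y _ => (hn y).1, fun y hy z hz =>
    ⟨(t.fiberEquiv y hy).trans (t.fiberEquiv z hz).symm, fun a b => ?_⟩⟩
  have := (ht z hz).symm (t.fiberEquiv z hz).symm_apply_apply (t.fiberEquiv z hz).apply_symm_apply
  simp only [ContinuousLinearEquiv.trans_apply]
  rw [ht y hy, this]

variable [∀ x, IsScalarTower 𝕜 (E x) (E x)] [∀ x, SMulCommClass 𝕜 (E x) (E x)]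
  [∀ x, CompleteSpace (E x)] {G : Type*} [Group G] [TopologicalSpace G] [IsTopologicalGroup G]
  [CompactSpace G] [T2Space G] [T2Space X] [ParacompactSpace X] [MulAction G X]
  [ContinuousSMul G X] {α : BundleAction 𝕜 E G}

theorem AlgLocallyHomogeneous.algEquivariantlyLocallyTrivial (h : AlgLocallyHomogeneous 𝕜 E)
    (hE : IsBanachAlgebraBundle 𝕜 E) (hα : α.IsMultiplicative)
    (hss : ∀ x, IsJacobsonSemisimple (E x)) : AlgEquivariantlyLocallyTrivial α := fun x => by
  obtain ⟨hfd, hdim⟩ := h.locallyHomogeneous.finrank_eq x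
  obtain ⟨fr, N, P, hN, hNf, hx, hinv, hP, hPx, he⟩ :=
    hE.toIsBanachBundle.exists_equivariantField α x hdim
  have hT := fr.isTrivializingField hN hNf hx hinv hP hPx he
  obtain ⟨V, Q, hV, hQ, hQm, -⟩ := hT.exists_multiplicative hα hE
    (fun a => (hss x).eq_zero_of_isNilpotent) fr fun y hy => hNf hy.1
  obtain ⟨t, ht, rfl, hta⟩ := hQ.exists_localTriv hE.continuous_proj fr
    fun y hy => hNf (hV hy).1
  refine ⟨E x, inferInstance, inferInstance, inferInstance, inferInstance, inferInstance, t, _, ht,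
    fun y hy a b => ?_, fun k => hα.rep_mul x k⟩
  rw [hta, hta, hta, hQm y hy]

end AlgebraMain

/-! ### C⋆ bundles -/

section CStar

variable {X : Type u} {E : X → Type v} [∀ x, NonUnitalCStarAlgebra (E x)]

/-- The self-adjoint part of a family of linear maps. -/
noncomputable def starSymmetrize {x : X} (P : ∀ y, E y →ₗ[ℂ] E x) (y : X) : E y →ₗ[ℂ] E x :=
  (2⁻¹ : ℂ) • (P y + (starLinearEquiv ℂ (A := E x)).toLinearMap.comp
    ((P y).comp (starLinearEquiv ℂ (A := E y)).toLinearMap))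

theorem starSymmetrize_apply {x : X} (P : ∀ y, E y →ₗ[ℂ] E x) (y : X) (a : E y) :
    starSymmetrize P y a = (2⁻¹ : ℂ) • (P y a + star (P y (star a))) := rfl

theorem starSymmetrize_star {x : X} (P : ∀ y, E y →ₗ[ℂ] E x) (y : X) (a : E y) :
    starSymmetrize P y (star a) = star (starSymmetrize P y a) := by
  simp [starSymmetrize_apply, add_comm]

theorem fiberCast_star {y z : X} (h : y = z) (a : E y) :
    fiberCast ℂ h (star a) = star (fiberCast ℂ h a) := by
  subst h
  rfl

theorem BundleAction.IsStarMultiplicative.rep_star [TopologicalSpace (Tot E)] {G : Type*} [Group G]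
    [TopologicalSpace G] [MulAction G X] {α : BundleAction ℂ E G} (hα : α.IsStarMultiplicative)
    (x : X) (k : MulAction.stabilizer G x) : PreservesStar (α.rep x k) := fun a => by
  rw [BundleAction.rep, LinearMap.comp_apply, (hα k x).2, fiberCast_star]
  rfl

variable [TopologicalSpace X]

theorem CStarLocallyHomogeneous.locallyHomogeneous (h : CStarLocallyHomogeneous E) :
    LocallyHomogeneous ℂ E := fun x => by
  obtain ⟨U, hU, hx, hfd, hiso⟩ := h x
  exact ⟨U, hU, hx, hfd, fun y hy z hz => ⟨(hiso y hy z hz).choose⟩⟩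

variable [TopologicalSpace (Tot E)]

theorem CStarLocallyTrivial.cstarLocallyHomogeneous (hs : Subhomogeneous ℂ E)
    (h : CStarLocallyTrivial E) : CStarLocallyHomogeneous E := fun x => by
  obtain ⟨F, _, t, hx, ht⟩ := h x
  obtain ⟨n, hn⟩ := hs
  refine ⟨t.toTriv.baseSet, t.toTriv.open_baseSet, hx, fun y _ => (hn y).1, fun y hy z hz =>
    ⟨(t.fiberEquiv y hy).trans (t.fiberEquiv z hz).symm, fun a b => ?_, fun a => ?_⟩⟩
  · have := (ht z hz).1.symm (t.fiberEquiv z hz).symm_apply_apply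
      (t.fiberEquiv z hz).apply_symm_apply
    simp only [ContinuousLinearEquiv.trans_apply]
    rw [(ht y hy).1, this]
  · have := (ht z hz).2.symm (t.fiberEquiv z hz).symm_apply_apply
      (t.fiberEquiv z hz).apply_symm_apply
    simp only [ContinuousLinearEquiv.trans_apply]
    rw [(ht y hy).2, this]

variable {G : Type*} [Group G] [TopologicalSpace G] [MulAction G X] {α : BundleAction ℂ E G}

theorem IsCStarBundle.isFieldOn_starSymmetrize (hE : IsCStarBundle E) {x : X} {N : Set X}
    {P : ∀ y, E y →ₗ[ℂ] E x} (hP : IsFieldOn N P) : IsFieldOn N (starSymmetrize P) := by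
  have h1 : ContinuousOn (fun p : Tot E => P p.proj (star p.snd)) (TotalSpace.proj ⁻¹' N) :=
    hP.comp (f := fun p : Tot E => (⟨p.proj, star p.snd⟩ : Tot E)) hE.continuous_star.continuousOn
      fun p hp => hp
  exact (hP.add h1.star).const_smul (2⁻¹ : ℂ)

variable [IsTopologicalGroup G] [CompactSpace G] [T2Space G] [T2Space X] [ParacompactSpace X]
  [ContinuousSMul G X]

theorem CStarLocallyHomogeneous.cstarEquivariantlyLocallyTrivial (h : CStarLocallyHomogeneous E)
    (hE : IsCStarBundle E) (hα : α.IsStarMultiplicative) :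
    CStarEquivariantlyLocallyTrivial α := fun x => by
  obtain ⟨hfd, hdim⟩ := h.locallyHomogeneous.finrank_eq x
  obtain ⟨fr, N, P, hN, hNf, hx, hinv, hP, hPx, he⟩ :=
    hE.toIsBanachBundle.exists_equivariantField α x hdim
  have hαm : α.IsMultiplicative := fun g y => (hα g y).1
  -- Symmetrizing keeps the field equivariant and the identity at x, because the action commutes
  -- with the involutions. Once P is ⋆-preserving, the transported products are compatible with the
  -- involution of `E x`, and rigidity respects it.
  have hT := fr.isTrivializingField (α := α) hN hNf hx hinv (hE.isFieldOn_starSymmetrize hP)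
    (fun a => by
      rw [starSymmetrize_apply, hPx, hPx, star_star, ← two_smul ℂ a, inv_smul_smul₀ two_ne_zero])
    (fun k y hy a => by
      rw [starSymmetrize_apply, starSymmetrize_apply, ← (hα k y).2, he k y hy, he k y hy,
        ← hα.rep_star x k, map_smul, map_add])
  obtain ⟨V, Q, hV, hQ, hQm, hQs⟩ := hT.exists_multiplicative hαm hE.toIsBanachAlgebraBundle
    (fun a => cstar_eq_zero_of_isNilpotent) fr fun y hy => hNf hy.1
  have hQs' := hQs (fun y => (starLinearEquiv ℂ (A := E y)).toLinearMap) continuous_star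
    (fun y a => star_star a) (fun y a b => star_mul a b) fun y _ a => starSymmetrize_star P y a
  obtain ⟨t, ht, rfl, hta⟩ := hQ.exists_localTriv hE.continuous_proj fr
    fun y hy => hNf (hV hy).1
  refine ⟨E x, inferInstance, t, _, ht, fun y hy => ⟨fun a b => ?_, fun a => ?_⟩,
    fun k => ⟨hαm.rep_mul x k, hα.rep_star x k⟩⟩
  · rw [hta, hta, hta, hQm y hy]
  · rw [hta, hta]
    exact hQs' y hy a

end CStar

end BanachBundles

/-! ### The equivalences for the four types of bundles -/

theorem mainTheorem12
    {d : ℕ} {G : Type*} [Group G] [TopologicalSpace G] [CompactSpace G] [T2Space G]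
    [ChartedSpace (EuclideanSpace ℝ (Fin d)) G] [LieGroup (𝓡 d) ∞ G]
    {X : Type*} [TopologicalSpace X] [T2Space X] [ParacompactSpace X]
    [MulAction G X] [ContinuousSMul G X]
    {𝕜 : Type*} [RCLike 𝕜] :
    -- Banach bundles
    (∀ (E : X → Type*) [∀ x, NormedAddCommGroup (E x)] [∀ x, NormedSpace 𝕜 (E x)]
        [∀ x, CompleteSpace (E x)] [TopologicalSpace (BanachBundles.Tot E)]
        (α : BanachBundles.BundleAction 𝕜 E G),
        BanachBundles.IsBanachBundle 𝕜 E → BanachBundles.Subhomogeneous 𝕜 E →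
        (BanachBundles.LocallyHomogeneous 𝕜 E ↔ BanachBundles.LocallyTrivial 𝕜 E) ∧
        (BanachBundles.LocallyHomogeneous 𝕜 E ↔ BanachBundles.EquivariantlyLocallyTrivial α)) ∧
    -- Hilbert bundles
    (∀ (E : X → Type*) [∀ x, NormedAddCommGroup (E x)] [∀ x, InnerProductSpace 𝕜 (E x)]
        [∀ x, CompleteSpace (E x)] [TopologicalSpace (BanachBundles.Tot E)]
        (α : BanachBundles.BundleAction 𝕜 E G),
        BanachBundles.IsBanachBundle 𝕜 E → BanachBundles.Subhomogeneous 𝕜 E →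
        (BanachBundles.LocallyHomogeneous 𝕜 E ↔ BanachBundles.HilbertLocallyTrivial 𝕜 E) ∧
        (BanachBundles.LocallyHomogeneous 𝕜 E ↔
          BanachBundles.HilbertEquivariantlyLocallyTrivial α)) ∧
    -- Banach-algebra bundles with semisimple fibers
    (∀ (E : X → Type*) [∀ x, NonUnitalNormedRing (E x)] [∀ x, NormedSpace 𝕜 (E x)]
        [∀ x, IsScalarTower 𝕜 (E x) (E x)] [∀ x, SMulCommClass 𝕜 (E x) (E x)]
        [∀ x, CompleteSpace (E x)] [TopologicalSpace (BanachBundles.Tot E)]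
        (α : BanachBundles.BundleAction 𝕜 E G), α.IsMultiplicative →
        BanachBundles.IsBanachAlgebraBundle 𝕜 E → BanachBundles.Subhomogeneous 𝕜 E →
        (∀ x, BanachBundles.IsJacobsonSemisimple (E x)) →
        (BanachBundles.AlgLocallyHomogeneous 𝕜 E ↔ BanachBundles.AlgLocallyTrivial 𝕜 E) ∧
        (BanachBundles.AlgLocallyHomogeneous 𝕜 E ↔
          BanachBundles.AlgEquivariantlyLocallyTrivial α)) ∧
    -- C⋆ bundles
    (∀ (E : X → Type*) [∀ x, NonUnitalCStarAlgebra (E x)]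
        [TopologicalSpace (BanachBundles.Tot E)]
        (α : BanachBundles.BundleAction ℂ E G), α.IsStarMultiplicative →
        BanachBundles.IsCStarBundle E → BanachBundles.Subhomogeneous ℂ E →
        (BanachBundles.CStarLocallyHomogeneous E ↔ BanachBundles.CStarLocallyTrivial E) ∧
        (BanachBundles.CStarLocallyHomogeneous E ↔
          BanachBundles.CStarEquivariantlyLocallyTrivial α)) := by
  have : IsTopologicalGroup G := topologicalGroup_of_lieGroup (𝓡 d) ∞
  refine ⟨?_, ?_, ?_, ?_⟩
  · intro E _ _ _ _ α hE hs
    -- Finite-dimensionality of the fibers, part of (a), comes from subhomogeneity; the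
    -- trivialization supplies only the isomorphisms.
    have hb : BanachBundles.LocallyTrivial 𝕜 E → BanachBundles.LocallyHomogeneous 𝕜 E :=
      fun h => BanachBundles.locallyHomogeneous_of_localTriv hs fun x => by
        obtain ⟨F, i1, i2, _, t, hx⟩ := h x
        exact ⟨F, i1, i2, t, hx⟩
    have hc : BanachBundles.LocallyHomogeneous 𝕜 E →
        BanachBundles.EquivariantlyLocallyTrivial α := fun h x => by
      obtain ⟨t, ρ, ht⟩ := hE.exists_equivariant_localTriv α h x
      exact ⟨E x, inferInstance, inferInstance, inferInstance, t, ρ, ht⟩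
    have hcb : BanachBundles.EquivariantlyLocallyTrivial α → BanachBundles.LocallyTrivial 𝕜 E :=
      fun h x => by
        obtain ⟨F, i1, i2, i3, t, ρ, ht⟩ := h x
        exact ⟨F, i1, i2, i3, t, ht.mem_baseSet⟩
    exact ⟨⟨fun h => hcb (hc h), hb⟩, hc, fun h => hb (hcb h)⟩
  · intro E _ _ _ _ α hE hs
    have hb : BanachBundles.HilbertLocallyTrivial 𝕜 E → BanachBundles.LocallyHomogeneous 𝕜 E :=
      fun h => BanachBundles.locallyHomogeneous_of_localTriv hs fun x => by
        obtain ⟨F, i1, i2, _, t, hx⟩ := h x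
        exact ⟨F, i1, inferInstance, t, hx⟩
    -- The model is the fiber `E x` with its own inner product; isomorphisms need not be isometric,
    -- so the Banach construction suffices.
    have hc : BanachBundles.LocallyHomogeneous 𝕜 E →
        BanachBundles.HilbertEquivariantlyLocallyTrivial α := fun h x => by
      obtain ⟨t, ρ, ht⟩ := hE.exists_equivariant_localTriv α h x
      exact ⟨E x, inferInstance, inferInstance, inferInstance, t, ρ, ht⟩
    have hcb : BanachBundles.HilbertEquivariantlyLocallyTrivial α →
        BanachBundles.HilbertLocallyTrivial 𝕜 E := fun h x => by
      obtain ⟨F, i1, i2, i3, t, ρ, ht⟩ := h x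
      exact ⟨F, i1, i2, i3, t, ht.mem_baseSet⟩
    exact ⟨⟨fun h => hcb (hc h), hb⟩, hc, fun h => hb (hcb h)⟩
  · intro E _ _ _ _ _ _ α hα hE hs hss
    have hc : BanachBundles.AlgLocallyHomogeneous 𝕜 E →
        BanachBundles.AlgEquivariantlyLocallyTrivial α := fun h =>
      h.algEquivariantlyLocallyTrivial hE hα hss
    have hcb : BanachBundles.AlgEquivariantlyLocallyTrivial α →
        BanachBundles.AlgLocallyTrivial 𝕜 E := fun h x => by
      obtain ⟨F, i1, i2, i3, i4, i5, t, ρ, ht, hm, -⟩ := h x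
      exact ⟨F, i1, i2, i3, i4, i5, t, ht.mem_baseSet, hm⟩
    exact ⟨⟨fun h => hcb (hc h), fun h => h.algLocallyHomogeneous hs⟩, hc,
      fun h => (hcb h).algLocallyHomogeneous hs⟩
  · intro E _ _ α hα hE hs
    have hc : BanachBundles.CStarLocallyHomogeneous E →
        BanachBundles.CStarEquivariantlyLocallyTrivial α := fun h =>
      h.cstarEquivariantlyLocallyTrivial hE hα
    have hcb : BanachBundles.CStarEquivariantlyLocallyTrivial α →
        BanachBundles.CStarLocallyTrivial E := fun h x => by
      obtain ⟨F, i1, t, ρ, ht, hm, -⟩ := h x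
      exact ⟨F, i1, t, ht.mem_baseSet, hm⟩
    exact ⟨⟨fun h => hcb (hc h), fun h => h.cstarLocallyHomogeneous hs⟩, hc,
      fun h => (hcb h).cstarLocallyHomogeneous hs⟩
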